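/- Let $C$ be a (compact, connected) tropical curve of genus $g$: a connected finite metric graph, up to subdivision, in which exactly the edges adjacent to $1$-valent vertices are infinitely long. Let $\mu$ be the Abel–Jacobi map, with respect to a base point $p_0\in C$, from divisors on $C$ to the Jacobian $J(C)=\Omega(C)^*/\Lambda$, where $\Omega(C)^*$ is the space of real-valued linear functionals on the lattice of integral $1$-forms and $\Lambda=H_1(C,\mathbb Z)$ is embedded in it by integration. Let $\operatorname{Pic}^{d}(C)$ be the set of divisor classes of degree $d$ modulo linear equivalence (principal divisors are the divisors of piecewise linear functions with integral slopes), let $W_{g-1}\subset\operatorname{Pic}^{g-1}(C)$ be the set of classes of effective divisors of degree $g-1$, and let $K=\sum_{p}(\operatorname{val}(p)-2)\,p$ be the canonical divisor. A theta characteristic is a class $\mathcal K\in\operatorname{Pic}^{g-1}(C)$ with $2\mathcal K=[K]$. Let $\Theta(x)=\max_{\lambda\in\Lambda}\{Q(\lambda,x)-\tfrac12Q(\lambda,\lambda)\}$ be the tropical theta function on $\Omega(C)^*$, where $Q$ is the bilinear form with $Q(\ell,\ell)=\operatorname{length}(\ell)$ for simple cycles $\ell$, and for $\lambda\in J(C)$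 let $D_\lambda$ be the divisor on $C$ obtained by pulling back along $\mu\colon C\to J(C)$ the translate by $\lambda$ of the divisor $[\Theta]$ of $\Theta$. Then $\mu$ induces a bijection $\varphi\colon\operatorname{Pic}^{g-1}(C)\to J(C)$; there is a (necessarily unique) element $\kappa\in J(C)$, the Riemann constant, such that for all $\lambda\in J(C)$ the divisor $D_\lambda$ has degree $g$ and $\mu(D_\lambda)+\kappa=\lambda$; and with $\mathcal K_0:=\varphi^{-1}(-\kappa)$ the following holds. The set of theta characteristics of $C$ is $\varphi^{-1}\bigl(-\kappa+\tfrac12\Lambda/\Lambda\bigr)$ (written $\mathcal K_0+\tfrac12\Lambda/\Lambda$), it has exactly $2^g$ elements, and among them only $\mathcal K_0$ is not in $W_{g-1}$. -/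

import Mathlib

open scoped Topology
open Filter

noncomputable section

/-- A tropical curve, presented by a connected finite graph (loops and multiple edges allowed).
`V` is the set of vertices which are not 1-valent, `E` the set of bounded edges (each with an
auxiliary direction and a positive length), `R` the set of leaves: a leaf `r` is a copy of
`[0, ∞]` glued at `0` to the vertex `root r`; its point `∞` is a 1-valent vertex, and all 1-valent
vertices of the curve arise so. (The curve `[-∞, ∞]` is presented with a 2-valent vertex.) -/
structure TropicalCurve where
  V : Type
  E : Type
  R : Type
  [fintypeV : Fintype V]
  [fintypeE : Fintype E]
  [fintypeR : Fintype R]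
  [decEqV : DecidableEq V]
  [decEqE : DecidableEq E]
  [decEqR : DecidableEq R]
  src : E → V
  tgt : E → V
  root : R → V
  len : E → ℝ
  len_pos : ∀ e, 0 < len e
  nonempty : Nonempty V
  connected : ∀ v w : V, Relation.EqvGen (fun a b => ∃ e, src e = a ∧ tgt e = b) v w
  not_univalent : ∀ v : V, Nat.card {e // src e = v} + Nat.card {e // tgt e = v}
    + Nat.card {r // root r = v} ≠ 1

namespace TropicalCurve

attribute [instance] fintypeV fintypeE fintypeR decEqV decEqE decEqR

variable (C : TropicalCurve)

/-! ### Points and tangent directions -/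

/-- The points of the curve at finite distance, that is, without the 1-valent vertices. -/
inductive FinPoint : Type
  | vertex (v : C.V) : FinPoint
  | onEdge (e : C.E) (t : ℝ) (h₀ : 0 < t) (h₁ : t < C.len e) : FinPoint
  | onLeaf (r : C.R) (t : ℝ) (h₀ : 0 < t) : FinPoint

/-- The points of the curve: the finite points, and the end at infinity of each leaf. -/
abbrev Point : Type := C.FinPoint ⊕ C.R

/-- The arc-length parametrization of the edge `e` by `[0, len e]`. -/
def edgePt (e : C.E) (t : ℝ) : C.FinPoint :=
  if h₀ : 0 < t then
    if h₁ : t < C.len e then .onEdge e t h₀ h₁ else .vertex (C.tgt e)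
  else .vertex (C.src e)

/-- The arc-length parametrization of the finite part of the leaf `r` by `[0, ∞)`. -/
def leafPt (r : C.R) (t : ℝ) : C.FinPoint :=
  if h₀ : 0 < t then .onLeaf r t h₀ else .vertex (C.root r)

/-- Tangent directions: an edge or a leaf, traversed forwards (`true`, for a leaf: towards
infinity) or backwards (`false`). -/
abbrev Direction : Type := (C.E ⊕ C.R) × Bool

/-- The direction is an outward direction at the vertex `v`. -/
def startsAt (v : C.V) : C.Direction → Bool
  | (.inl e, true) => C.src e = v
  | (.inl e, false) => C.tgt e = v
  | (.inr r, true) => C.root r = v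
  | (.inr _, false) => false

/-- The outward primitive tangent directions at a point. A loop gives two of them at its vertex. -/
def dirs : C.Point → Finset C.Direction
  | .inl (.vertex v) => Finset.univ.filter fun d => C.startsAt v d = true
  | .inl (.onEdge e _ _ _) => {(.inl e, true), (.inl e, false)}
  | .inl (.onLeaf r _ _) => {(.inr r, true), (.inr r, false)}
  | .inr r => {(.inr r, false)}

/-- The valence of a point. -/
def val (p : C.Point) : ℕ := (C.dirs p).card

/-- The point at (small) distance `s` from the finite point `x` in the direction `d`
(used only for directions `d` at `x`). -/
def move : C.FinPoint → C.Direction → ℝ → C.FinPoint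
  | .vertex _, (.inl e, true), s => C.edgePt e s
  | .vertex _, (.inl e, false), s => C.edgePt e (C.len e - s)
  | .vertex _, (.inr r, _), s => C.leafPt r s
  | .onEdge e t _ _, (_, true), s => C.edgePt e (t + s)
  | .onEdge e t _ _, (_, false), s => C.edgePt e (t - s)
  | .onLeaf r t _, (_, true), s => C.leafPt r (t + s)
  | .onLeaf r t _, (_, false), s => C.leafPt r (t - s)

/-! ### Divisors and linear equivalence -/

/-- Divisors: finite formal integral combinations of points. -/
abbrev Divisor : Type := C.Point →₀ ℤ

/-- The degree of a divisor. -/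
def deg (D : C.Divisor) : ℤ := D.sum fun _ n => n

/-- Near `p`, the function `f` is linear in the direction `d`, with slope `m`. At the infinite end
of a leaf this means that `f` is eventually linear on the leaf, with slope `-m` with respect to the
coordinate growing towards infinity (so `f` may tend to `±∞` there). -/
def HasSlope (f : C.FinPoint → ℝ) (p : C.Point) (d : C.Direction) (m : ℤ) : Prop :=
  match p with
  | .inl x => ∀ᶠ s : ℝ in 𝓝[>] 0, f (C.move x d s) = f x + m * s
  | .inr r => ∃ a : ℝ, ∀ᶠ s : ℝ in atTop, f (C.leafPt r s) = a - m * s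

/-- `f` is a piecewise linear function with integral slopes on the curve, and `(f) = D`: at each
point `f` is linear with integral slope in each outward direction, and the multiplicity of the
point in `D` is the sum of these slopes. (As the curve is compact, such an `f` has finitely many
linear pieces.) The values at the infinite ends are determined by the others and not recorded. -/
def IsDivisorOf (f : C.FinPoint → ℝ) (D : C.Divisor) : Prop :=
  ∀ p : C.Point, ∃ m : C.Direction → ℤ,
    (∀ d ∈ C.dirs p, C.HasSlope f p d (m d)) ∧ D p = ∑ d ∈ C.dirs p, m d

/-- The group of principal divisors. -/
def principal : AddSubgroup C.Divisor where
  carrier := {D | ∃ f, C.IsDivisorOf f D}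
  zero_mem' := by
    refine ⟨fun _ => 0, fun p => ⟨fun _ => 0, fun d _ => ?_, by simp⟩⟩
    rcases p with x | r
    · simp [HasSlope]
    · exact ⟨0, by simp⟩
  add_mem' := by
    rintro D₁ D₂ ⟨f, hf⟩ ⟨g, hg⟩
    refine ⟨fun x => f x + g x, fun p => ?_⟩
    obtain ⟨m, hm, hD⟩ := hf p
    obtain ⟨n, hn, hD'⟩ := hg p
    refine ⟨fun d => m d + n d, fun d hd => ?_, by simp [hD, hD', Finset.sum_add_distrib]⟩
    have h₁ := hm d hd
    have h₂ := hn d hd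
    rcases p with x | r
    · filter_upwards [h₁, h₂] with s h h'
      rw [h, h']
      push_cast
      ring
    · obtain ⟨a, h₁⟩ := h₁
      obtain ⟨b, h₂⟩ := h₂
      refine ⟨a + b, ?_⟩
      filter_upwards [h₁, h₂] with s h h'
      rw [h, h']
      push_cast
      ring
  neg_mem' := by
    rintro D ⟨f, hf⟩
    refine ⟨fun x => -f x, fun p => ?_⟩
    obtain ⟨m, hm, hD⟩ := hf p
    refine ⟨fun d => -m d, fun d hd => ?_, by simp [hD]⟩
    have h₁ := hm d hd
    rcases p with x | r
    · filter_upwards [h₁] with s h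
      rw [h]
      push_cast
      ring
    · obtain ⟨a, h₁⟩ := h₁
      refine ⟨-a, ?_⟩
      filter_upwards [h₁] with s h
      rw [h]
      push_cast
      ring

/-- The Picard group: divisors modulo linear equivalence. -/
abbrev Pic : Type := C.Divisor ⧸ C.principal

/-- The linear equivalence class of a divisor. -/
def divisorClass (D : C.Divisor) : C.Pic := QuotientAddGroup.mk D

/-- `Pic^d`: the classes of divisors of degree `d`. -/
abbrev PicDeg (d : ℤ) : Type := {k : C.Pic // ∃ D : C.Divisor, C.deg D = d ∧ C.divisorClass D = k}

/-- `W_d ⊆ Pic^d`: the classes of effective divisors of degree `d`. -/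
def effectiveClasses (d : ℤ) : Set (C.PicDeg d) :=
  {k | ∃ D : C.Divisor, 0 ≤ D ∧ C.deg D = d ∧ C.divisorClass D = k.1}

/-- The canonical divisor `K = ∑ (val p - 2) p`. -/
def canonical : C.Divisor :=
  Finsupp.ofSupportFinite (fun p => (C.val p : ℤ) - 2) (by
    refine ((Set.finite_range (fun v : C.V => (Sum.inl (.vertex v) : C.Point))).union
      (Set.finite_range (fun r : C.R => (Sum.inr r : C.Point)))).subset ?_
    rintro (x | r) hp
    · cases x with
      | vertex v => exact Or.inl ⟨v, rfl⟩
      | onEdge e t h₀ h₁ => exact absurd (by simp [val, dirs]) hp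
      | onLeaf r t h₀ => exact absurd (by simp [val, dirs]) hp
    · exact Or.inr ⟨r, rfl⟩)

/-! ### The circuit lattice and the Jacobian -/

/-- The circuit lattice: integral flows on the bounded edges which are balanced at each vertex.
It plays two roles. An element `ω` is an integral 1-form, with slope `ω e` along `e`: the balancing
is the harmonicity at the vertices, and a form vanishes on leaves since it is harmonic at their
infinite ends. An element `c` is a cycle `∑ (c e) e` in `H₁(C, ℤ)`: the balancing is `∂ c = 0`, and
leaves do not occur in cycles. -/
def circuits : Submodule ℤ (C.E → ℤ) where
  carrier := {c | ∀ v : C.V,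
    (∑ e with C.src e = v, c e) = ∑ e with C.tgt e = v, c e}
  zero_mem' := by simp
  add_mem' := by
    intro a b ha hb v
    simp only [Pi.add_apply, Finset.sum_add_distrib, ha v, hb v]
  smul_mem' := by
    intro n a ha v
    simp only [Pi.smul_apply, ← Finset.smul_sum, ha v]

/-- The genus `b₁`, the rank of `H₁(C, ℤ)`. -/
def genus : ℕ := Module.finrank ℤ C.circuits

/-- `Ω(C)^*`, the real-valued linear functionals on the lattice of integral 1-forms. -/
abbrev OmegaDual : Type := C.circuits →ₗ[ℤ] ℝ

/-- The value `ω e` of an integral 1-form on the unit tangent vector of `e`. -/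
def edgeFunctional (e : C.E) : C.OmegaDual where
  toFun ω := ((ω.1 e : ℤ) : ℝ)
  map_add' := by intro a b; simp
  map_smul' := by intro n a; simp

/-- Integration of 1-forms over a cycle. -/
def cycleIntegral : C.circuits →+ C.OmegaDual where
  toFun c := ∑ e, ((c.1 e : ℝ) * C.len e) • C.edgeFunctional e
  map_zero' := by simp
  map_add' := by
    intro a b
    simp [add_mul, add_smul, Finset.sum_add_distrib]

/-- The lattice `Λ ⊆ Ω(C)^*` of integral cycles. -/
def lattice : AddSubgroup C.OmegaDual := C.cycleIntegral.range

/-- The tropical Jacobian `Ω(C)^* / Λ`. -/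
abbrev Jacobian : Type := C.OmegaDual ⧸ C.lattice

/-- The class in the Jacobian of a functional. -/
def toJacobian (x : C.OmegaDual) : C.Jacobian := QuotientAddGroup.mk x

/-- The subset `½Λ / Λ` of the Jacobian. -/
def halfPeriods : Set C.Jacobian :=
  {y | ∃ l ∈ C.lattice, y = C.toJacobian ((1 / 2 : ℝ) • l)}

/-! ### The Abel-Jacobi map -/

/-- The points of the closed leaf `r`. -/
def closedLeaf (r : C.R) : Set C.Point := {q | q = .inr r ∨ ∃ t : ℝ, q = .inl (C.leafPt r t)}

/-- `PathIntegral p q ℓ`: some path from `p` to `q`, a concatenation of segments on edges and on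
leaves, has `∫ ω = ℓ ω` for all integral 1-forms `ω`. Forms vanish on leaves. -/
inductive PathIntegral (p : C.Point) : C.Point → C.OmegaDual → Prop
  | nil : PathIntegral p p 0
  | edge (e : C.E) (s t : ℝ) (l : C.OmegaDual) (hs : s ∈ Set.Icc 0 (C.len e))
      (ht : t ∈ Set.Icc 0 (C.len e)) (h : PathIntegral p (.inl (C.edgePt e s)) l) :
      PathIntegral p (.inl (C.edgePt e t)) (l + (t - s) • C.edgeFunctional e)
  | leaf (r : C.R) (q q' : C.Point) (l : C.OmegaDual) (hq : q ∈ C.closedLeaf r)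
      (hq' : q' ∈ C.closedLeaf r) (h : PathIntegral p q l) : PathIntegral p q' l

theorem PathIntegral.trans {C : TropicalCurve} {p q r : C.Point} {l l' : C.OmegaDual}
    (h : C.PathIntegral p q l) (h' : C.PathIntegral q r l') : C.PathIntegral p r (l + l') := by
  induction h' with
  | nil => simpa using h
  | edge e s t l₂ hs ht _ ih => rw [← add_assoc]; exact .edge e s t _ hs ht ih
  | leaf r a b l₂ ha hb _ ih => exact .leaf r a b _ ha hb ih

theorem PathIntegral.symm {C : TropicalCurve} {p q : C.Point} {l : C.OmegaDual}
    (h : C.PathIntegral p q l) : ∃ l', C.PathIntegral q p l' := by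
  induction h with
  | nil => exact ⟨0, .nil⟩
  | edge e s t l₂ hs ht _ ih =>
    obtain ⟨l', h'⟩ := ih
    exact ⟨_, (PathIntegral.edge e t s 0 ht hs .nil).trans h'⟩
  | leaf r a b l₂ ha hb _ ih =>
    obtain ⟨l', h'⟩ := ih
    exact ⟨_, (PathIntegral.leaf r b a 0 hb ha .nil).trans h'⟩

theorem edgePt_zero (e : C.E) : C.edgePt e 0 = .vertex (C.src e) := by simp [edgePt]

theorem edgePt_len (e : C.E) : C.edgePt e (C.len e) = .vertex (C.tgt e) := by
  simp [edgePt, C.len_pos e]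

theorem leafPt_zero (r : C.R) : C.leafPt r 0 = .vertex (C.root r) := by simp [leafPt]

theorem exists_pathIntegral_vertices (v w : C.V) :
    ∃ l, C.PathIntegral (.inl (.vertex v)) (.inl (.vertex w)) l := by
  induction C.connected v w with
  | rel a b h =>
    obtain ⟨e, rfl, rfl⟩ := h
    have h := PathIntegral.edge (C := C) (p := .inl (C.edgePt e 0)) e 0 (C.len e) 0
      ⟨le_rfl, (C.len_pos e).le⟩ ⟨(C.len_pos e).le, le_rfl⟩ .nil
    rw [edgePt_zero, edgePt_len] at h
    exact ⟨_, h⟩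
  | refl a => exact ⟨0, .nil⟩
  | symm a b _ ih => exact ih.choose_spec.symm
  | trans a b c _ _ ih₁ ih₂ => exact ⟨_, ih₁.choose_spec.trans ih₂.choose_spec⟩

theorem exists_pathIntegral_vertex (p : C.Point) :
    ∃ v l, C.PathIntegral (.inl (.vertex v)) p l := by
  rcases p with x | r
  · cases x with
    | vertex v => exact ⟨v, 0, .nil⟩
    | onEdge e t h₀ h₁ =>
      have h := PathIntegral.edge (C := C) (p := .inl (C.edgePt e 0)) e 0 t 0
        ⟨le_rfl, (C.len_pos e).le⟩ ⟨h₀.le, h₁.le⟩ .nil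
      have h' : C.edgePt e t = .onEdge e t h₀ h₁ := by simp [edgePt, h₀, h₁]
      rw [edgePt_zero, h'] at h
      exact ⟨_, _, h⟩
    | onLeaf r t h₀ =>
      refine ⟨C.root r, 0, .leaf r (.inl (.vertex (C.root r))) _ 0 (Or.inr ⟨0, ?_⟩)
        (Or.inr ⟨t, ?_⟩) .nil⟩
      · rw [leafPt_zero]
      · simp [leafPt, h₀]
  · refine ⟨C.root r, 0, .leaf r (.inl (.vertex (C.root r))) _ 0 (Or.inr ⟨0, ?_⟩)
      (Or.inl rfl) .nil⟩
    rw [leafPt_zero]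

theorem exists_pathIntegral (p q : C.Point) : ∃ l, C.PathIntegral p q l := by
  obtain ⟨v, l, hv⟩ := C.exists_pathIntegral_vertex p
  obtain ⟨w, l', hw⟩ := C.exists_pathIntegral_vertex q
  obtain ⟨l₁, h₁⟩ := hv.symm
  obtain ⟨l₂, h₂⟩ := C.exists_pathIntegral_vertices v w
  exact ⟨_, (h₁.trans h₂).trans hw⟩

/-- `ω ↦ ∫_p^q ω` along a chosen path from `p` to `q`. -/
def pathIntegral (p q : C.Point) : C.OmegaDual := (C.exists_pathIntegral p q).choose

theorem pathIntegral_spec (p q : C.Point) : C.PathIntegral p q (C.pathIntegral p q) :=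
  (C.exists_pathIntegral p q).choose_spec

/-- The Abel-Jacobi map `μ` on divisors, with base point `p₀`. -/
def abelJacobi (p₀ : C.Point) (D : C.Divisor) : C.Jacobian :=
  C.toJacobian (D.sum fun p n => n • C.pathIntegral p₀ p)

/-! ### The theta function and the Riemann constant -/

/-- The pairing `Q(c, x)` of a cycle `c ∈ Λ` with `x ∈ Ω(C)^*`. It is linear in `x`, and the next
two lemmas show that it restricts on `Λ` to the symmetric form given by the lengths. -/
def Q (c : C.circuits) (x : C.OmegaDual) : ℝ := x c

theorem Q_cycleIntegral (c c' : C.circuits) :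
    C.Q c (C.cycleIntegral c') = ∑ e, (c.1 e : ℝ) * c'.1 e * C.len e := by
  simp only [Q, cycleIntegral, edgeFunctional, AddMonoidHom.coe_mk, ZeroHom.coe_mk,
    LinearMap.sum_apply, LinearMap.smul_apply, LinearMap.coe_mk, AddHom.coe_mk, smul_eq_mul]
  exact Finset.sum_congr rfl fun e _ => by ring

theorem Q_simple (c : C.circuits) (hc : ∀ e, |c.1 e| ≤ 1) :
    C.Q c (C.cycleIntegral c) = ∑ e with c.1 e ≠ 0, C.len e := by
  rw [Q_cycleIntegral, Finset.sum_filter]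
  refine Finset.sum_congr rfl fun e _ => ?_
  have h := abs_le.mp (hc e)
  have h' : c.1 e = -1 ∨ c.1 e = 0 ∨ c.1 e = 1 := by omega
  rcases h' with h' | h' | h' <;> simp [h']

/-- The tropical theta function `Θ(x) = max_{c ∈ Λ} (Q(c, x) - ½ Q(c, c))`. -/
def theta (x : C.OmegaDual) : ℝ :=
  ⨆ c : C.circuits, (C.Q c x - 1 / 2 * C.Q c (C.cycleIntegral c))

/-- The velocity in `Ω(C)^*` of a lift of the Abel-Jacobi map of the curve, in a direction. -/
def tangent : C.Direction → C.OmegaDual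
  | (.inl e, true) => C.edgeFunctional e
  | (.inl e, false) => -C.edgeFunctional e
  | (.inr _, _) => 0

/-- `D` is the pull-back `D_λ = μ^*[Θ_λ]` of the translate by `l` of the theta divisor under the
Abel-Jacobi map of the curve, `l` being a lift of `λ`: on a lift of `μ` near a point `p`, the local
equation `Θ(x - l)` of `[Θ_λ]` has integral slopes in the outward directions at `p`, and their sum
is the multiplicity of `p` in `D`. -/
def IsThetaPullback (p₀ : C.Point) (l : C.OmegaDual) (D : C.Divisor) : Prop :=
  ∀ p : C.Point, ∃ m : C.Direction → ℤ,
    (∀ d ∈ C.dirs p, ∀ᶠ s : ℝ in 𝓝[>] 0,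
      C.theta (C.pathIntegral p₀ p + s • C.tangent d - l)
        = C.theta (C.pathIntegral p₀ p - l) + m d * s) ∧
    D p = ∑ d ∈ C.dirs p, m d

/-- `κ` is the Riemann constant: for each `λ` in the Jacobian, the divisor `D_λ` (exists and) has
degree `g`, and `μ(D_λ) + κ = λ`. -/
def IsRiemannConstant (p₀ : C.Point) (κ : C.Jacobian) : Prop :=
  ∀ l : C.OmegaDual, ∃ D : C.Divisor, C.IsThetaPullback p₀ l D ∧ C.deg D = C.genus ∧
    C.abelJacobi p₀ D + κ = C.toJacobian l

/-- The theta characteristics: the classes `k ∈ Pic^{g-1}` with `2k = K`. -/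
def thetaCharacteristics : Set (C.PicDeg ((C.genus : ℤ) - 1)) :=
  {k | (2 : ℕ) • k.1 = C.divisorClass C.canonical}

end TropicalCurve

end

/-! Everything is governed by one explicit divisor M, `midDivisor`: the sum of the midpoints of the
bounded edges minus the sum of the vertices not at infinity. By Euler's formula its degree is g-1,
and three facts about it give the theorem.

(1) The Riemann constant is -μ(M). On a lift of μ the theta function is only quasi-periodic, so
around the graph it fails to close up by explicit affine terms. The divergence theorem
`degHom_and_liftSum_eq`, which allows such a twist, computes the degree and the sum in J(C) of the
pulled-back divisor (`degHom_and_jac_thetaDivisor`). The twist contributes the trace of a projection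
onto the circuit lattice, which is g. What remains of the sum is the translation plus μ(M).

(2) 2M is equivalent to K, because twice a midpoint has the same image in J(C) as the two ends of
its edge (`jac_liftSum_canonical`). By Abel's theorem `mem_principal_iff`, and because (1) makes μ
surjective on classes of degree g-1, the theta characteristics form a torsor under the 2-torsion
½Λ/Λ, a group of order 2^g.

(3) M is not equivalent to an effective divisor, by a maximum principle
(`sub_midDivisor_notMem_principal`). Conversely, let c/2 be a nonzero half period. The affine terms
of Θ at c/2 are permuted by b ↦ c-b, which has no fixed point because c is not twice a cycle. So the
maximum is attained twice and Θ has a corner at c/2. Translating the theta divisor until the corner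
lies on the curve, and subtracting the point there, leaves an effective divisor of degree g-1 in the
required class (`exists_effective_of_corner`). -/

/-! ### Piecewise linear functions of one real variable -/

/-- To the right of `t`, the function `f` is affine with integral slope `m`. -/
def RightSlope (f : ℝ → ℝ) (t : ℝ) (m : ℤ) : Prop :=
  ∀ᶠ s : ℝ in 𝓝[>] 0, f (t + s) = f t + m * s

/-- To the left of `t`, the function `f` is affine with integral outward slope `m`. -/
def LeftSlope (f : ℝ → ℝ) (t : ℝ) (m : ℤ) : Prop :=
  ∀ᶠ s : ℝ in 𝓝[>] 0, f (t - s) = f t + m * s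

theorem eventually_nhdsGT_zero_iff {p : ℝ → Prop} :
    (∀ᶠ s : ℝ in 𝓝[>] 0, p s) ↔ ∃ δ > 0, ∀ s, 0 < s → s < δ → p s := by
  rw [eventually_nhdsWithin_iff, Metric.eventually_nhds_iff]
  constructor
  · rintro ⟨δ, hδ, h⟩
    exact ⟨δ, hδ, fun s h₀ h₁ => h (by rwa [Real.dist_0_eq_abs, abs_of_pos h₀]) h₀⟩
  · rintro ⟨δ, hδ, h⟩
    refine ⟨δ, hδ, fun s hs h₀ => h s h₀ ?_⟩
    rwa [Real.dist_0_eq_abs, abs_of_pos h₀] at hs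

theorem slope_unique {g : ℝ → ℝ} {m n : ℤ} {a : ℝ}
    (hm : ∀ᶠ s : ℝ in 𝓝[>] 0, g s = a + m * s) (hn : ∀ᶠ s : ℝ in 𝓝[>] 0, g s = a + n * s) :
    m = n := by
  obtain ⟨δ, hδ, h⟩ := eventually_nhdsGT_zero_iff.mp (hm.and hn)
  obtain ⟨h₁, h₂⟩ := h (δ / 2) (by linarith) (by linarith)
  have : (m : ℝ) * (δ / 2) = n * (δ / 2) := by linarith
  exact_mod_cast mul_right_cancel₀ (by positivity) this

/-- The break points in the open interval `(a, b)` of a piecewise linear function with outward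
slopes `r` to the right and `l` to the left, together with its total second derivative and the
first moment of the latter. -/
def HasBreakpoints (f : ℝ → ℝ) (r l : ℝ → ℤ) (a b : ℝ) : Prop :=
  ∃ T : Finset ℝ, (∀ t ∈ T, t ∈ Set.Ioo a b) ∧ (∀ t ∈ Set.Ioo a b, r t + l t ≠ 0 → t ∈ T) ∧
    ∑ t ∈ T, (r t + l t) = -(l b) - r a ∧
    ∑ t ∈ T, ((r t + l t : ℤ) : ℝ) * t = -(b * l b) - a * r a - (f b - f a)

/-- The point `b` is always added as a break point, even with zero jump: its jump `r b + l b`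
cancels the boundary terms that the two pieces have there. -/
theorem HasBreakpoints.trans {f : ℝ → ℝ} {r l : ℝ → ℤ} {a b c : ℝ} (hab : a < b) (hbc : b < c)
    (h : HasBreakpoints f r l a b) (h' : HasBreakpoints f r l b c) :
    HasBreakpoints f r l a c := by
  obtain ⟨T, hT, hT', hs, hm⟩ := h
  obtain ⟨U, hU, hU', hs', hm'⟩ := h'
  have hb : b ∉ U := fun hb => lt_irrefl _ (hU b hb).1
  have hd : Disjoint T (insert b U) := by
    rw [Finset.disjoint_left]
    intro t ht htU
    rcases Finset.mem_insert.mp htU with rfl | htU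
    · exact lt_irrefl _ (hT t ht).2
    · exact lt_asymm (hT t ht).2 (hU t htU).1
  refine ⟨T ∪ insert b U, fun t ht => ?_, fun t ht hne => ?_, ?_, ?_⟩
  · rcases Finset.mem_union.mp ht with ht | ht
    · exact ⟨(hT t ht).1, (hT t ht).2.trans hbc⟩
    · rcases Finset.mem_insert.mp ht with rfl | ht
      · exact ⟨hab, hbc⟩
      · exact ⟨hab.trans (hU t ht).1, (hU t ht).2⟩
  · rw [Finset.mem_union, Finset.mem_insert]
    rcases lt_trichotomy t b with h | h | h
    · exact Or.inl (hT' t ⟨ht.1, h⟩ hne)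
    · exact Or.inr (Or.inl h)
    · exact Or.inr (Or.inr (hU' t ⟨h, ht.2⟩ hne))
  · rw [Finset.sum_union hd, Finset.sum_insert hb, hs, hs']
    ring
  · rw [Finset.sum_union hd, Finset.sum_insert hb, hm, hm']
    push_cast
    ring

theorem hasBreakpoints_of_affine {f : ℝ → ℝ} {r l : ℝ → ℤ} {a b : ℝ} (hab : a < b) {m : ℤ}
    {k : ℝ} (hf : ∀ t ∈ Set.Icc a b, f t = k + m * t)
    (hr : ∀ t ∈ Set.Ico a b, RightSlope f t (r t)) (hl : ∀ t ∈ Set.Ioc a b, LeftSlope f t (l t)) :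
    HasBreakpoints f r l a b := by
  have hr' : ∀ t ∈ Set.Ico a b, r t = m := by
    intro t ht
    refine slope_unique (hr t ht) (eventually_nhdsGT_zero_iff.mpr
      ⟨b - t, by linarith [ht.2], fun s h₀ h₁ => ?_⟩)
    rw [hf t ⟨ht.1, ht.2.le⟩, hf (t + s) ⟨by linarith [ht.1], by linarith⟩]
    ring
  have hl' : ∀ t ∈ Set.Ioc a b, l t = -m := by
    intro t ht
    refine slope_unique (hl t ht) (eventually_nhdsGT_zero_iff.mpr
      ⟨t - a, by linarith [ht.1], fun s h₀ h₁ => ?_⟩)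
    rw [hf t ⟨ht.1.le, ht.2⟩, hf (t - s) ⟨by linarith, by linarith [ht.2]⟩]
    push_cast
    ring
  refine ⟨∅, by simp, fun t ht hne => (hne ?_).elim, ?_, ?_⟩
  · rw [hr' t ⟨ht.1.le, ht.2⟩, hl' t ⟨ht.1, ht.2.le⟩]
    ring
  · rw [hr' a ⟨le_rfl, hab⟩, hl' b ⟨hab, le_rfl⟩]
    simp
  · rw [hr' a ⟨le_rfl, hab⟩, hl' b ⟨hab, le_rfl⟩, hf a ⟨le_rfl, hab.le⟩, hf b ⟨hab.le, le_rfl⟩]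
    push_cast
    simp only [Finset.sum_empty]
    ring

/-- Compactness of `[a, b]`: the supremum of the points reachable with finitely many breaks is
itself reachable by the germ on its left, and could be passed by the germ on its right if it were
smaller than `b`. The two sums are then f' evaluated at the ends and integration by parts for ∫ t
f''. -/
theorem hasBreakpoints {f : ℝ → ℝ} {r l : ℝ → ℤ} {a b : ℝ} (hab : a < b)
    (hr : ∀ t ∈ Set.Ico a b, RightSlope f t (r t)) (hl : ∀ t ∈ Set.Ioc a b, LeftSlope f t (l t)) :
    HasBreakpoints f r l a b := by
  have key : ∀ x y m k, a ≤ x → x < y → y ≤ b → (∀ t ∈ Set.Icc x y, f t = k + (m : ℤ) * t) →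
      HasBreakpoints f r l x y := fun x y m k hx hxy hy h => hasBreakpoints_of_affine hxy h
    (fun t ht => hr t ⟨hx.trans ht.1, ht.2.trans_le hy⟩)
    (fun t ht => hl t ⟨hx.trans_lt ht.1, ht.2.trans hy⟩)
  -- The case `x = a` is separate because `HasBreakpoints` on the degenerate interval would force `r
  -- a + l a = 0`.
  let S : Set ℝ := {x | x ∈ Set.Icc a b ∧ (x = a ∨ HasBreakpoints f r l a x)}
  have haS : a ∈ S := ⟨⟨le_rfl, hab.le⟩, Or.inl rfl⟩
  have hbd : BddAbove S := ⟨b, fun x hx => hx.1.2⟩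
  have step : ∀ x ∈ S, ∀ y, x < y → y ≤ b → HasBreakpoints f r l x y → y ∈ S := by
    rintro x ⟨hx, hx'⟩ y hxy hy h
    refine ⟨⟨hx.1.trans hxy.le, hy⟩, Or.inr ?_⟩
    rcases hx' with rfl | hx'
    · exact h
    · rcases hx.1.eq_or_lt with rfl | hax
      · exact h
      · exact hx'.trans hax hxy h
  set c := sSup S with hc
  have hac : a ≤ c := le_csSup hbd haS
  have hcb : c ≤ b := csSup_le ⟨a, haS⟩ fun x hx => hx.1.2
  have hcS : c ∈ S := by
    rcases hac.eq_or_lt with h | hac'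
    · rwa [← h]
    obtain ⟨δ, hδ, h⟩ := eventually_nhdsGT_zero_iff.mp (hl c ⟨hac', hcb⟩)
    obtain ⟨y, hy, hcy⟩ := exists_lt_of_lt_csSup ⟨a, haS⟩ (show c - δ < sSup S by linarith)
    rcases (le_csSup hbd hy).eq_or_lt with h' | h'
    · rwa [hc, ← h']
    refine step y hy c h' hcb (key y c (-(l c)) (f c + l c * c) hy.1.1 h' hcb fun t ht => ?_)
    rcases ht.2.eq_or_lt with rfl | htc
    · push_cast
      ring
    have := h (c - t) (by linarith) (by linarith [ht.1])
    rw [sub_sub_cancel] at this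
    rw [this]
    push_cast
    ring
  rcases hcb.eq_or_lt with h | hcb'
  · rw [h] at hcS
    exact hcS.2.resolve_left hab.ne'
  exfalso
  obtain ⟨δ, hδ, h⟩ := eventually_nhdsGT_zero_iff.mp (hr c ⟨hac, hcb'⟩)
  have hy : c < min b (c + δ / 2) := lt_min hcb' (by linarith)
  refine absurd (le_csSup hbd (step c hcS _ hy (min_le_left _ _)
    (key _ _ (r c) (f c - r c * c) hac hy (min_le_left _ _) fun t ht => ?_))) (not_le.mpr hy)
  rcases ht.1.eq_or_lt with rfl | htc
  · ring
  have := h (t - c) (by linarith) (by linarith [ht.2.trans (min_le_right _ _)])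
  rw [add_sub_cancel] at this
  rw [this]
  ring

/-! ### Functions with prescribed break points -/

/-- The affine function of slope `n` to the left of the finite set `T`, bent by `k u` at each
`u ∈ T`. -/
def bent (a : ℝ) (n : ℤ) (T : Finset ℝ) (k : ℝ → ℤ) (t : ℝ) : ℝ :=
  a + n * t + ∑ u ∈ T, (k u : ℝ) * max (t - u) 0

theorem rightSlope_max (u t : ℝ) :
    RightSlope (fun t => max (t - u) 0) t (if u ≤ t then 1 else 0) := by
  split_ifs with h
  · refine eventually_nhdsGT_zero_iff.mpr ⟨1, one_pos, fun s h₀ _ => ?_⟩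
    simp only
    rw [max_eq_left (by linarith), max_eq_left (by linarith)]
    push_cast
    ring
  · refine eventually_nhdsGT_zero_iff.mpr ⟨u - t, by linarith, fun s h₀ _ => ?_⟩
    simp only
    rw [max_eq_right (by linarith), max_eq_right (by linarith)]
    simp

theorem leftSlope_max (u t : ℝ) :
    LeftSlope (fun t => max (t - u) 0) t (if u < t then -1 else 0) := by
  split_ifs with h
  · refine eventually_nhdsGT_zero_iff.mpr ⟨t - u, by linarith, fun s h₀ _ => ?_⟩
    simp only
    rw [max_eq_left (by linarith), max_eq_left (by linarith)]
    push_cast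
    ring
  · refine eventually_nhdsGT_zero_iff.mpr ⟨1, one_pos, fun s h₀ _ => ?_⟩
    simp only
    rw [max_eq_right (by linarith), max_eq_right (by linarith)]
    simp

theorem rightSlope_bent (a : ℝ) (n : ℤ) (T : Finset ℝ) (k : ℝ → ℤ) (t : ℝ) :
    RightSlope (bent a n T k) t (n + ∑ u ∈ T, k u * if u ≤ t then 1 else 0) := by
  have h : ∀ᶠ s : ℝ in 𝓝[>] 0, ∀ u ∈ T, max (t + s - u) 0 =
      max (t - u) 0 + ((if u ≤ t then 1 else 0 : ℤ) : ℝ) * s :=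
    (Finset.eventually_all T).mpr fun u _ => rightSlope_max u t
  filter_upwards [h] with s hs
  simp only [bent]
  rw [Finset.sum_congr rfl fun u hu => by rw [hs u hu, mul_add]]
  rw [Finset.sum_add_distrib]
  push_cast
  simp only [add_mul, Finset.sum_mul, mul_assoc]
  ring

theorem leftSlope_bent (a : ℝ) (n : ℤ) (T : Finset ℝ) (k : ℝ → ℤ) (t : ℝ) :
    LeftSlope (bent a n T k) t (-n + ∑ u ∈ T, k u * if u < t then -1 else 0) := by
  have h : ∀ᶠ s : ℝ in 𝓝[>] 0, ∀ u ∈ T, max (t - s - u) 0 =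
      max (t - u) 0 + ((if u < t then -1 else 0 : ℤ) : ℝ) * s :=
    (Finset.eventually_all T).mpr fun u _ => leftSlope_max u t
  filter_upwards [h] with s hs
  simp only [bent]
  rw [Finset.sum_congr rfl fun u hu => by rw [hs u hu, mul_add]]
  rw [Finset.sum_add_distrib]
  push_cast
  simp only [add_mul, Finset.sum_mul, mul_assoc]
  ring

/-- The two one-sided slopes differ in sign except for the bend at `u = t`, which is counted on the
right only. -/
theorem bent_jump (n : ℤ) (T : Finset ℝ) (k : ℝ → ℤ) (t : ℝ) (hk : t ∉ T → k t = 0) :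
    (n + ∑ u ∈ T, k u * if u ≤ t then 1 else 0) + (-n + ∑ u ∈ T, k u * if u < t then -1 else 0)
      = k t := by
  have : ∀ u ∈ T, (k u * if u ≤ t then 1 else 0) + (k u * if u < t then -1 else 0)
      = if t = u then k u else 0 := by
    intro u _
    rcases lt_trichotomy u t with h | h | h
    · simp [h, h.le, h.ne']
    · simp [h]
    · simp [not_lt.mpr h.le, not_le.mpr h, h.ne]
  calc _ = ∑ u ∈ T, ((k u * if u ≤ t then 1 else 0) + (k u * if u < t then -1 else 0)) := by
        rw [Finset.sum_add_distrib]; ring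
    _ = if t ∈ T then k t else 0 := by rw [Finset.sum_congr rfl this, Finset.sum_ite_eq]
    _ = k t := by split_ifs with h <;> simp_all

theorem bent_of_le {a : ℝ} {n : ℤ} {T : Finset ℝ} {k : ℝ → ℤ} {t : ℝ} (h : ∀ u ∈ T, t ≤ u) :
    bent a n T k t = a + n * t := by
  rw [bent, Finset.sum_eq_zero, add_zero]
  intro u hu
  rw [max_eq_right (by linarith [h u hu]), mul_zero]

theorem bent_of_ge {a : ℝ} {n : ℤ} {T : Finset ℝ} {k : ℝ → ℤ} {t : ℝ} (h : ∀ u ∈ T, u ≤ t) :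
    bent a n T k t = (a - ∑ u ∈ T, k u * u) + ((n + ∑ u ∈ T, k u : ℤ) : ℝ) * t := by
  rw [bent, Finset.sum_congr rfl fun u hu => by rw [max_eq_left (by linarith [h u hu]), mul_sub]]
  rw [Finset.sum_sub_distrib, ← Finset.sum_mul]
  push_cast
  ring

theorem RightSlope.congr {f g : ℝ → ℝ} {t b : ℝ} {m : ℤ} (h : RightSlope f t m) (htb : t < b)
    (hfg : ∀ s ∈ Set.Ico t b, g s = f s) : RightSlope g t m := by
  have hb : ∀ᶠ s : ℝ in 𝓝[>] 0, t < t + s ∧ t + s < b :=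
    eventually_nhdsGT_zero_iff.mpr ⟨b - t, by linarith, fun s _ _ => ⟨by linarith, by linarith⟩⟩
  filter_upwards [h, hb] with s hs hb
  rw [hfg _ ⟨hb.1.le, hb.2⟩, hfg t ⟨le_rfl, htb⟩, hs]

theorem LeftSlope.congr {f g : ℝ → ℝ} {t a : ℝ} {m : ℤ} (h : LeftSlope f t m) (hat : a < t)
    (hfg : ∀ s ∈ Set.Ioc a t, g s = f s) : LeftSlope g t m := by
  have hb : ∀ᶠ s : ℝ in 𝓝[>] 0, a < t - s ∧ t - s < t :=
    eventually_nhdsGT_zero_iff.mpr ⟨t - a, by linarith, fun s _ _ => ⟨by linarith, by linarith⟩⟩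
  filter_upwards [h, hb] with s hs hb
  rw [hfg _ ⟨hb.1, hb.2.le⟩, hfg t ⟨hat, le_rfl⟩, hs]

/-- Used to regroup sums over vertices of sums over adjacent edges or leaves. -/
theorem Fintype.sum_sum_fiber {ι κ A : Type*} [Fintype ι] [Fintype κ] [DecidableEq κ]
    [AddCommMonoid A] (s : ι → κ) (h : ι → κ → A) :
    ∑ v, ∑ i with s i = v, h i v = ∑ i, h i (s i) := by
  rw [← Finset.sum_fiberwise (s := Finset.univ) (g := s)]
  exact Finset.sum_congr rfl fun v _ => Finset.sum_congr rfl fun e he => by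
    rw [(Finset.mem_filter.mp he).2]

noncomputable section

namespace TropicalCurve

variable (C : TropicalCurve)

/-! ### Chains and the boundary map -/

/-- The boundary of an integral chain on the bounded edges. -/
def boundary : (C.E → ℤ) →ₗ[ℤ] (C.V → ℤ) where
  toFun c v := (∑ e with C.tgt e = v, c e) - ∑ e with C.src e = v, c e
  map_add' a b := by
    ext v
    simp only [Pi.add_apply, Finset.sum_add_distrib]
    ring
  map_smul' n a := by
    ext v
    simp only [Pi.smul_apply, ← Finset.smul_sum, RingHom.id_apply, smul_sub]

theorem boundary_apply (c : C.E → ℤ) (v : C.V) :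
    C.boundary c v = (∑ e with C.tgt e = v, c e) - ∑ e with C.src e = v, c e := rfl

variable {C} in
theorem mem_circuits_iff {c : C.E → ℤ} : c ∈ C.circuits ↔ C.boundary c = 0 := by
  rw [funext_iff]
  exact forall_congr' fun v => by
    rw [boundary_apply, Pi.zero_apply, sub_eq_zero, eq_comm]

theorem boundary_single (e : C.E) :
    C.boundary (Pi.single e 1) = Pi.single (C.tgt e) 1 - Pi.single (C.src e) 1 := by
  ext v
  simp [boundary_apply, Pi.single_apply, eq_comm]

/-- Summation by parts. -/
theorem sum_smul_coboundary {A : Type*} [AddCommGroup A] (c : C.E → ℤ) (φ : C.V → A) :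
    ∑ e, c e • (φ (C.tgt e) - φ (C.src e)) = ∑ v, C.boundary c v • φ v := by
  simp only [boundary_apply, sub_smul, smul_sub, Finset.sum_sub_distrib, Finset.sum_smul]
  rw [Fintype.sum_sum_fiber C.tgt fun e v => c e • φ v,
    Fintype.sum_sum_fiber C.src fun e v => c e • φ v]

theorem sum_circuit_smul_coboundary {A : Type*} [AddCommGroup A] (c : C.circuits) (φ : C.V → A) :
    ∑ e, c.1 e • (φ (C.tgt e) - φ (C.src e)) = 0 := by
  rw [sum_smul_coboundary, mem_circuits_iff.mp c.2]
  simp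

theorem sum_mul_coboundary (c : C.circuits) (φ : C.V → ℝ) :
    ∑ e, (c.1 e : ℝ) * (φ (C.tgt e) - φ (C.src e)) = 0 := by
  have := C.sum_circuit_smul_coboundary c φ
  simpa only [zsmul_eq_mul] using this

theorem exists_chain (v w : C.V) :
    ∃ γ, C.boundary γ = Pi.single w 1 - Pi.single v 1 := by
  induction C.connected v w with
  | rel a b h =>
    obtain ⟨e, rfl, rfl⟩ := h
    exact ⟨_, C.boundary_single e⟩
  | refl a => exact ⟨0, by simp⟩
  | symm a b _ ih =>
    obtain ⟨γ, hγ⟩ := ih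
    exact ⟨-γ, by rw [map_neg, hγ, neg_sub]⟩
  | trans a b c _ _ ih₁ ih₂ =>
    obtain ⟨γ, hγ⟩ := ih₁
    obtain ⟨δ, hδ⟩ := ih₂
    exact ⟨γ + δ, by rw [map_add, hγ, hδ]; abel⟩

/-- A base vertex. -/
def baseVertex : C.V := Classical.choice C.nonempty

/-- A chain from the base vertex to `v`. -/
def chain (v : C.V) : C.E → ℤ :=
  if v = C.baseVertex then 0 else (C.exists_chain C.baseVertex v).choose

theorem chain_baseVertex : C.chain C.baseVertex = 0 := if_pos rfl

theorem boundary_chain (v : C.V) :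
    C.boundary (C.chain v) = Pi.single v 1 - Pi.single C.baseVertex 1 := by
  unfold chain
  split_ifs with h
  · rw [h, map_zero, sub_self]
  · exact (C.exists_chain C.baseVertex v).choose_spec

/-- The cycle consisting of the edge `e` and the chosen chains to its end points. -/
def edgeCycle (e : C.E) : C.circuits :=
  ⟨C.chain (C.src e) + Pi.single e 1 - C.chain (C.tgt e), mem_circuits_iff.mpr (by
    rw [map_sub, map_add, boundary_chain, boundary_chain, boundary_single]
    abel)⟩

theorem edgeCycle_apply (e f : C.E) :
    (C.edgeCycle e).1 f = C.chain (C.src e) f + (Pi.single e 1 : C.E → ℤ) f - C.chain (C.tgt e) f :=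
  rfl

/-- The chains to the end points cancel by summation by parts, as `c` has no boundary. So the edge
cycles generate the circuits, and extending the formula to all chains gives a projection onto the
circuits. -/
theorem sum_smul_edgeCycle (c : C.circuits) : ∑ e, c.1 e • C.edgeCycle e = c := by
  ext f
  have h := C.sum_circuit_smul_coboundary c fun v => C.chain v f
  simp only [smul_eq_mul] at h
  have h' : ∑ e, c.1 e * (Pi.single e 1 : C.E → ℤ) f = c.1 f := by
    simp [Pi.single_apply]
  rw [AddSubmonoidClass.coe_finsetSum, Finset.sum_apply]
  calc ∑ e, (c.1 e • (C.edgeCycle e).1) f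
      = ∑ e, c.1 e * (Pi.single e 1 : C.E → ℤ) f
        - ∑ e, c.1 e * (C.chain (C.tgt e) f - C.chain (C.src e) f) := by
        rw [← Finset.sum_sub_distrib]
        refine Finset.sum_congr rfl fun e _ => ?_
        rw [Pi.smul_apply, edgeCycle_apply, smul_eq_mul]
        ring
    _ = _ := by rw [h, h', sub_zero]

/-- The left side is the trace of that projection in the basis of edges, and the trace of a
projection is the rank of its image. -/
theorem sum_edgeCycle_diag : ∑ e, (C.edgeCycle e).1 e = C.genus := by
  let f : (C.E → ℤ) →ₗ[ℤ] (C.E → ℤ) :=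
    C.circuits.subtype ∘ₗ Fintype.linearCombination ℤ C.edgeCycle
  have hf : LinearMap.IsProj C.circuits f := by
    refine ⟨fun x => Subtype.property _, fun x hx => ?_⟩
    exact congrArg Subtype.val (C.sum_smul_edgeCycle ⟨x, hx⟩)
  have h := hf.trace
  rw [LinearMap.trace_eq_matrix_trace ℤ (Pi.basisFun ℤ C.E), Matrix.trace] at h
  rw [genus, ← h]
  refine Finset.sum_congr rfl fun e _ => ?_
  rw [Matrix.diag_apply, LinearMap.toMatrix_apply]
  simp [f, Fintype.linearCombination_apply_single]

/-- The same trace computed by hand: each edge contributes 1, and the chain terms regroup into the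
coefficients of `∂(chain v)` at `v`, which are 1 except for 0 at the base vertex. -/
theorem genus_eq : (C.genus : ℤ) = Fintype.card C.E - Fintype.card C.V + 1 := by
  have h : ∀ w, C.boundary (fun e => C.chain w e) w = 1 - if w = C.baseVertex then 1 else 0 := by
    intro w
    rw [boundary_chain]
    simp [Pi.single_apply]
  have h₁ : ∑ e, (C.chain (C.tgt e) e - C.chain (C.src e) e) = Fintype.card C.V - 1 := by
    have : ∑ v, C.boundary (C.chain v) v = Fintype.card C.V - 1 := by
      rw [Finset.sum_congr rfl fun v _ => h v]
      simp
    rw [← this]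
    simp only [boundary_apply, Finset.sum_sub_distrib]
    rw [Fintype.sum_sum_fiber C.tgt fun e v => C.chain v e,
      Fintype.sum_sum_fiber C.src fun e v => C.chain v e]
  rw [← sum_edgeCycle_diag]
  have h₂ : ∑ e, (C.edgeCycle e).1 e
      = ∑ e : C.E, (1 : ℤ) - ∑ e, (C.chain (C.tgt e) e - C.chain (C.src e) e) := by
    rw [← Finset.sum_sub_distrib]
    refine Finset.sum_congr rfl fun e _ => ?_
    rw [edgeCycle_apply, Pi.single_eq_same]
    ring
  rw [h₂, h₁, Finset.sum_const, Finset.card_univ, nsmul_eq_mul, mul_one]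
  ring

/-! ### Lifts to the universal cover of the Jacobian -/

@[simp]
theorem edgeFunctional_apply (e : C.E) (c : C.circuits) : C.edgeFunctional e c = (c.1 e : ℝ) := rfl

/-- Integration of 1-forms over a chain. -/
def chainIntegral : (C.E → ℤ) →+ C.OmegaDual where
  toFun c := ∑ e, ((c e : ℝ) * C.len e) • C.edgeFunctional e
  map_zero' := by simp
  map_add' := by
    intro a b
    simp [add_mul, add_smul, Finset.sum_add_distrib]

theorem chainIntegral_apply (c : C.E → ℤ) (b : C.circuits) :
    C.chainIntegral c b = ∑ e, (c e : ℝ) * b.1 e * C.len e := by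
  simp only [chainIntegral, AddMonoidHom.coe_mk, ZeroHom.coe_mk,
    LinearMap.sum_apply, LinearMap.smul_apply, edgeFunctional_apply, smul_eq_mul]
  exact Finset.sum_congr rfl fun e _ => by ring

theorem chainIntegral_coe (c : C.circuits) : C.chainIntegral c.1 = C.cycleIntegral c := rfl

theorem chainIntegral_single (e : C.E) :
    C.chainIntegral (Pi.single e 1) = C.len e • C.edgeFunctional e := by
  ext b
  rw [chainIntegral_apply]
  simp [Pi.single_apply, mul_comm]

/-- The quotient map to the Jacobian. -/
def jac : C.OmegaDual →+ C.Jacobian := QuotientAddGroup.mk' C.lattice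

theorem toJacobian_eq (x : C.OmegaDual) : C.toJacobian x = C.jac x := rfl

variable {C} in
theorem jac_eq_zero_iff {x : C.OmegaDual} : C.jac x = 0 ↔ x ∈ C.lattice :=
  QuotientAddGroup.eq_zero_iff x

@[simp]
theorem jac_cycleIntegral (c : C.circuits) : C.jac (C.cycleIntegral c) = 0 :=
  jac_eq_zero_iff.mpr ⟨c, rfl⟩

theorem jac_surjective : Function.Surjective C.jac := QuotientAddGroup.mk'_surjective _

/-- A lift of the Abel-Jacobi map, based at the base vertex, on the vertices. -/
def vertexLift (v : C.V) : C.OmegaDual := C.chainIntegral (C.chain v)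

theorem vertexLift_baseVertex : C.vertexLift C.baseVertex = 0 := by
  rw [vertexLift, chain_baseVertex, map_zero]

/-- Following `e` from the lift of its source, one arrives at the lift of its target only up to the
period of `edgeCycle e`. This period is the source of every monodromy term below. -/
theorem vertexLift_tgt (e : C.E) :
    C.vertexLift (C.tgt e) =
      C.vertexLift (C.src e) + C.len e • C.edgeFunctional e - C.cycleIntegral (C.edgeCycle e) := by
  rw [← chainIntegral_coe, ← chainIntegral_single, vertexLift, vertexLift, ← map_add, ← map_sub]
  congr 1
  simp only [edgeCycle]
  abel

/-- A lift of the Abel-Jacobi map, based at the base vertex. -/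
def lift : C.Point → C.OmegaDual
  | .inl (.vertex v) => C.vertexLift v
  | .inl (.onEdge e t _ _) => C.vertexLift (C.src e) + t • C.edgeFunctional e
  | .inl (.onLeaf r _ _) => C.vertexLift (C.root r)
  | .inr r => C.vertexLift (C.root r)

theorem edgePt_of_mem {e : C.E} {t : ℝ} (h : t ∈ Set.Ioo 0 (C.len e)) :
    C.edgePt e t = .onEdge e t h.1 h.2 := by
  simp [edgePt, h.1, h.2]

theorem leafPt_of_pos {r : C.R} {t : ℝ} (h : 0 < t) : C.leafPt r t = .onLeaf r t h := by
  simp [leafPt, h]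

theorem lift_leafPt (r : C.R) (t : ℝ) : C.lift (.inl (C.leafPt r t)) = C.vertexLift (C.root r) := by
  unfold leafPt
  split_ifs <;> rfl

theorem lift_edgePt {e : C.E} {t : ℝ} (h : t ∈ Set.Ico 0 (C.len e)) :
    C.lift (.inl (C.edgePt e t)) = C.vertexLift (C.src e) + t • C.edgeFunctional e := by
  rcases h.1.eq_or_lt with rfl | h₀
  · rw [edgePt_zero, zero_smul, add_zero]
    rfl
  · rw [C.edgePt_of_mem ⟨h₀, h.2⟩]
    rfl

theorem jac_lift_edgePt {e : C.E} {t : ℝ} (h : t ∈ Set.Icc 0 (C.len e)) :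
    C.jac (C.lift (.inl (C.edgePt e t)))
      = C.jac (C.vertexLift (C.src e) + t • C.edgeFunctional e) := by
  rcases h.2.eq_or_lt with rfl | h₁
  · rw [edgePt_len]
    change C.jac (C.vertexLift _) = _
    rw [vertexLift_tgt, map_sub, jac_cycleIntegral, sub_zero]
  · rw [C.lift_edgePt ⟨h.1, h₁⟩]

theorem lift_of_mem_closedLeaf {r : C.R} {q : C.Point} (h : q ∈ C.closedLeaf r) :
    C.lift q = C.vertexLift (C.root r) := by
  rcases h with rfl | ⟨t, rfl⟩
  · rfl
  · exact C.lift_leafPt r t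

variable {C} in
-- Modulo Λ the integral depends only on the end points, so the arbitrary choice in `pathIntegral`
-- is harmless.
theorem PathIntegral.jac_eq {p q : C.Point} {l : C.OmegaDual} (h : C.PathIntegral p q l) :
    C.jac l = C.jac (C.lift q) - C.jac (C.lift p) := by
  induction h with
  | nil => simp
  | edge e s t l hs ht _ ih =>
    rw [map_add, ih, C.jac_lift_edgePt hs, C.jac_lift_edgePt ht, sub_smul]
    simp only [map_add, map_sub]
    abel
  | leaf r a b l ha hb _ ih =>
    rw [ih, C.lift_of_mem_closedLeaf ha, C.lift_of_mem_closedLeaf hb]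

theorem jac_pathIntegral (p q : C.Point) :
    C.jac (C.pathIntegral p q) = C.jac (C.lift q) - C.jac (C.lift p) :=
  (C.pathIntegral_spec p q).jac_eq

/-- The degree as a homomorphism. -/
def degHom : C.Divisor →+ ℤ := Finsupp.liftAddHom fun _ => AddMonoidHom.id ℤ

theorem deg_eq (D : C.Divisor) : C.deg D = C.degHom D := rfl

/-- The sum in `Ω(C)^*` of the lifts of the points of a divisor. -/
def liftSum : C.Divisor →+ C.OmegaDual :=
  Finsupp.liftAddHom fun p => zmultiplesHom C.OmegaDual (C.lift p)

theorem liftSum_apply (D : C.Divisor) : C.liftSum D = D.sum fun p n => n • C.lift p := rfl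

@[simp]
theorem degHom_single (p : C.Point) (n : ℤ) : C.degHom (Finsupp.single p n) = n := by
  simp [degHom]

@[simp]
theorem liftSum_single (p : C.Point) (n : ℤ) :
    C.liftSum (Finsupp.single p n) = n • C.lift p := by
  simp [liftSum]

theorem abelJacobi_eq (p₀ : C.Point) (D : C.Divisor) :
    C.abelJacobi p₀ D = C.jac (C.liftSum D) - C.degHom D • C.jac (C.lift p₀) := by
  have h : C.abelJacobi p₀ D = D.sum fun p n => n • C.jac (C.pathIntegral p₀ p) := by
    rw [abelJacobi, toJacobian_eq, map_finsuppSum]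
    exact Finsupp.sum_congr fun p _ => map_zsmul _ _ _
  rw [h, liftSum_apply, map_finsuppSum, ← deg_eq, deg]
  simp only [Finsupp.sum, jac_pathIntegral, smul_sub, Finset.sum_sub_distrib, Finset.sum_smul,
    map_zsmul]

/-- The finite sets may exceed the support, so break points of any function with divisor `D` can
serve. -/
theorem sum_eq {A : Type*} [AddCommMonoid A] (D : C.Divisor) (T : C.E → Finset ℝ)
    (S : C.R → Finset ℝ) (hT : ∀ e, ∀ t ∈ T e, t ∈ Set.Ioo 0 (C.len e)) (hS : ∀ r, ∀ t ∈ S r, 0 < t)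
    (hT' : ∀ e, ∀ t ∈ Set.Ioo 0 (C.len e), D (.inl (C.edgePt e t)) ≠ 0 → t ∈ T e)
    (hS' : ∀ r t, 0 < t → D (.inl (C.leafPt r t)) ≠ 0 → t ∈ S r)
    (g : C.Point → ℤ → A) (hg : ∀ p, g p 0 = 0) :
    D.sum g = ∑ v, g (.inl (.vertex v)) (D (.inl (.vertex v)))
      + ∑ e, ∑ t ∈ T e, g (.inl (C.edgePt e t)) (D (.inl (C.edgePt e t)))
      + ∑ r, (g (.inr r) (D (.inr r))
        + ∑ t ∈ S r, g (.inl (C.leafPt r t)) (D (.inl (C.leafPt r t)))) := by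
  classical
  let P : Finset (C.V ⊕ ((Σ _ : C.E, ℝ) ⊕ ((Σ _ : C.R, ℝ) ⊕ C.R))) :=
    Finset.univ.disjSum ((Finset.univ.sigma T).disjSum
      ((Finset.univ.sigma S).disjSum Finset.univ))
  let ι : C.V ⊕ ((Σ _ : C.E, ℝ) ⊕ ((Σ _ : C.R, ℝ) ⊕ C.R)) → C.Point :=
    Sum.elim (fun v => .inl (.vertex v)) (Sum.elim (fun x => .inl (C.edgePt x.1 x.2))
      (Sum.elim (fun x => .inl (C.leafPt x.1 x.2)) .inr))
  have hι : Set.InjOn ι P := by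
    rintro (v | ⟨e, t⟩ | ⟨r, t⟩ | r) hx (v' | ⟨e', t'⟩ | ⟨r', t'⟩ | r') hy h <;>
    simp only [P, Finset.mem_coe, Finset.inl_mem_disjSum, Finset.inr_mem_disjSum,
      Finset.mem_sigma, Finset.mem_univ, true_and] at hx hy <;>
    simp only [ι, Sum.elim_inl, Sum.elim_inr] at h <;>
    (try rw [C.edgePt_of_mem (hT _ _ hx)] at h) <;>
    (try rw [C.edgePt_of_mem (hT _ _ hy)] at h) <;>
    (try rw [C.leafPt_of_pos (hS _ _ hx)] at h) <;>
    (try rw [C.leafPt_of_pos (hS _ _ hy)] at h) <;>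
    simp at h ⊢ <;> exact h
  have hsub : D.support ⊆ P.image ι := by
    intro p hp
    rw [Finsupp.mem_support_iff] at hp
    rw [Finset.mem_image]
    rcases p with (v | ⟨e, t, h₀, h₁⟩ | ⟨r, t, h₀⟩) | r
    · exact ⟨.inl v, by simp [P], rfl⟩
    · have := C.edgePt_of_mem (e := e) ⟨h₀, h₁⟩
      exact ⟨.inr (.inl ⟨e, t⟩), by simp [P, hT' e t ⟨h₀, h₁⟩ (by rwa [this])], by simp [ι, this]⟩
    · have := C.leafPt_of_pos (r := r) h₀
      exact ⟨.inr (.inr (.inl ⟨r, t⟩)), by simp [P, hS' r t h₀ (by rwa [this])], by simp [ι, this]⟩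
    · exact ⟨.inr (.inr (.inr r)), by simp [P], rfl⟩
  rw [Finsupp.sum_of_support_subset D hsub g (fun p _ => hg p), Finset.sum_image hι]
  simp only [P, Finset.sum_disjSum, Finset.sum_sigma, ι, Sum.elim_inl, Sum.elim_inr,
    Finset.sum_add_distrib]
  abel

theorem exists_finset_edge (D : C.Divisor) (e : C.E) : ∃ T : Finset ℝ,
    (∀ t ∈ T, t ∈ Set.Ioo 0 (C.len e)) ∧
    ∀ t ∈ Set.Ioo 0 (C.len e), D (.inl (C.edgePt e t)) ≠ 0 → t ∈ T := by
  have hfin : {t | t ∈ Set.Ioo 0 (C.len e) ∧ D (.inl (C.edgePt e t)) ≠ 0}.Finite := by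
    refine Set.Finite.of_finite_image (f := fun t => (Sum.inl (C.edgePt e t) : C.Point))
      (D.support.finite_toSet.subset ?_) ?_
    · rintro _ ⟨t, ht, rfl⟩
      simpa using ht.2
    · intro t ht s hs h
      simpa [C.edgePt_of_mem ht.1, C.edgePt_of_mem hs.1] using h
  exact ⟨hfin.toFinset, fun t ht => ((hfin.mem_toFinset).mp ht).1,
    fun t ht h => hfin.mem_toFinset.mpr ⟨ht, h⟩⟩

theorem exists_finset_leaf (D : C.Divisor) (r : C.R) : ∃ S : Finset ℝ,
    (∀ t ∈ S, 0 < t) ∧ ∀ t, 0 < t → D (.inl (C.leafPt r t)) ≠ 0 → t ∈ S := by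
  have hfin : {t | 0 < t ∧ D (.inl (C.leafPt r t)) ≠ 0}.Finite := by
    refine Set.Finite.of_finite_image (f := fun t => (Sum.inl (C.leafPt r t) : C.Point))
      (D.support.finite_toSet.subset ?_) ?_
    · rintro _ ⟨t, ht, rfl⟩
      simpa using ht.2
    · intro t ht s hs h
      simpa [C.leafPt_of_pos ht.1, C.leafPt_of_pos hs.1] using h
  exact ⟨hfin.toFinset, fun t ht => ((hfin.mem_toFinset).mp ht).1,
    fun t ht h => hfin.mem_toFinset.mpr ⟨ht, h⟩⟩

/-! ### The divergence theorem -/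

/-- A divisor given by edgewise piecewise linear functions `f e` with outward slopes `ρ e` to the
right and `l e` to the left, which match at the vertices up to a twist `w`. -/
theorem degHom_and_liftSum_eq (D : C.Divisor) (f : C.E → ℝ → ℝ) (ρ l : C.E → ℝ → ℤ)
    (hr : ∀ e, ∀ t ∈ Set.Ico 0 (C.len e), RightSlope (f e) t (ρ e t))
    (hl : ∀ e, ∀ t ∈ Set.Ioc 0 (C.len e), LeftSlope (f e) t (l e t))
    (hD : ∀ e, ∀ t ∈ Set.Ioo 0 (C.len e), D (.inl (C.edgePt e t)) = ρ e t + l e t)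
    (σ : C.R → ℤ)
    (hleaf : ∀ r, ∃ S : Finset ℝ, (∀ t ∈ S, 0 < t) ∧
      (∀ t, 0 < t → D (.inl (C.leafPt r t)) ≠ 0 → t ∈ S) ∧
      D (.inr r) + ∑ t ∈ S, D (.inl (C.leafPt r t)) = -σ r)
    (w : C.E → ℤ)
    (hv : ∀ v, D (.inl (.vertex v)) = ∑ e with C.src e = v, ρ e 0
      + ∑ e with C.tgt e = v, (l e (C.len e) + w e) + ∑ r with C.root r = v, σ r) :
    C.degHom D = ∑ e, w e ∧
    C.liftSum D = ∑ e, (-(f e (C.len e) - f e 0) • C.edgeFunctional e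
      - l e (C.len e) • C.cycleIntegral (C.edgeCycle e) + w e • C.vertexLift (C.tgt e)) := by
  choose S hS hS' hSsum using hleaf
  choose T hT hT' hTsum hTmom using fun e => hasBreakpoints (C.len_pos e) (hr e) (hl e)
  have hDT : ∀ e, ∀ t ∈ T e, D (.inl (C.edgePt e t)) = ρ e t + l e t := fun e t ht =>
    hD e t (hT e t ht)
  have hT'' : ∀ e, ∀ t ∈ Set.Ioo 0 (C.len e), D (.inl (C.edgePt e t)) ≠ 0 → t ∈ T e :=
    fun e t ht h => hT' e t ht (by rwa [← hD e t ht])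
  constructor
  · rw [← deg_eq, deg, C.sum_eq D T S hT hS hT'' hS' _ fun _ => rfl]
    simp only [hSsum, hv, Finset.sum_add_distrib]
    rw [Fintype.sum_sum_fiber C.src fun e _ => ρ e 0,
      Fintype.sum_sum_fiber C.tgt fun e _ => l e (C.len e),
      Fintype.sum_sum_fiber C.tgt fun e _ => w e,
      Fintype.sum_sum_fiber C.root fun r _ => σ r,
      Finset.sum_congr rfl fun e _ => (Finset.sum_congr rfl (hDT e)).trans (hTsum e)]
    simp only [Finset.sum_sub_distrib, Finset.sum_neg_distrib]
    ring
  -- The lift is affine in `t` on an edge, so the points inside it contribute the total jump times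
  -- the lift of the source plus the first moment times `edgeFunctional e`.
  · have hedge : ∀ e, ∑ t ∈ T e, D (.inl (C.edgePt e t)) • C.lift (.inl (C.edgePt e t))
        = (-(l e (C.len e)) - ρ e 0) • C.vertexLift (C.src e)
          + (-(C.len e * l e (C.len e)) - (f e (C.len e) - f e 0)) • C.edgeFunctional e := by
      intro e
      calc _ = ∑ t ∈ T e, ((ρ e t + l e t) • C.vertexLift (C.src e)
            + (((ρ e t + l e t : ℤ) : ℝ) * t) • C.edgeFunctional e) := by
            refine Finset.sum_congr rfl fun t ht => ?_
            rw [hDT e t ht, C.lift_edgePt ⟨(hT e t ht).1.le, (hT e t ht).2⟩, smul_add,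
              mul_smul, Int.cast_smul_eq_zsmul]
        _ = _ := by
            rw [Finset.sum_add_distrib, ← Finset.sum_smul, ← Finset.sum_smul, hTsum, hTmom,
              zero_mul, sub_zero]
    have hR : ∀ r, D (.inr r) • C.lift (.inr r)
        + ∑ t ∈ S r, D (.inl (C.leafPt r t)) • C.lift (.inl (C.leafPt r t))
        = -σ r • C.vertexLift (C.root r) := by
      intro r
      rw [← hSsum]
      simp only [lift_leafPt, add_smul, Finset.sum_smul]
      rfl
    rw [liftSum_apply, C.sum_eq D T S hT hS hT'' hS' _ fun p => zero_smul ℤ (C.lift p)]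
    simp only [hedge, hR]
    have hV : ∑ v, D (.inl (.vertex v)) • C.lift (.inl (.vertex v))
        = ∑ e, ρ e 0 • C.vertexLift (C.src e)
          + ∑ e, (l e (C.len e) + w e) • C.vertexLift (C.tgt e)
          + ∑ r, σ r • C.vertexLift (C.root r) := by
      simp only [hv, add_smul, Finset.sum_smul, Finset.sum_add_distrib]
      rw [Fintype.sum_sum_fiber C.src fun e v => ρ e 0 • C.lift (.inl (.vertex v)),
        Fintype.sum_sum_fiber C.tgt fun e v => l e (C.len e) • C.lift (.inl (.vertex v)),
        Fintype.sum_sum_fiber C.tgt fun e v => w e • C.lift (.inl (.vertex v)),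
        Fintype.sum_sum_fiber C.root fun r v => σ r • C.lift (.inl (.vertex v))]
      rfl
    rw [hV]
    -- The lift is constant on a leaf, so the points of the leaf cancel its slope at the root.
    have hcancel : ∑ r, σ r • C.vertexLift (C.root r) + ∑ r, -σ r • C.vertexLift (C.root r) = 0 := by
      rw [← Finset.sum_add_distrib]
      exact Finset.sum_eq_zero fun r _ => by rw [neg_smul, add_neg_cancel]
    rw [add_assoc, add_assoc, add_left_comm (∑ r, σ r • _), hcancel, add_zero,
      ← Finset.sum_add_distrib, ← Finset.sum_add_distrib]
    refine Finset.sum_congr rfl fun e _ => ?_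
    -- Moving the contribution at the target to the source by `vertexLift_tgt` cancels all slopes
    -- and leaves an integral multiple of a period.
    rw [add_smul (l e (C.len e)), show l e (C.len e) • C.vertexLift (C.tgt e) = _ from
      congrArg _ (C.vertexLift_tgt e)]
    simp only [← Int.cast_smul_eq_zsmul ℝ, Int.cast_neg, Int.cast_sub]
    module

/-! ### Principal divisors -/

@[simp]
theorem startsAt_inl_true (v : C.V) (e : C.E) :
    C.startsAt v (.inl e, true) = decide (C.src e = v) := rfl

@[simp]
theorem startsAt_inl_false (v : C.V) (e : C.E) :
    C.startsAt v (.inl e, false) = decide (C.tgt e = v) := rfl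

@[simp]
theorem startsAt_inr_true (v : C.V) (r : C.R) :
    C.startsAt v (.inr r, true) = decide (C.root r = v) := rfl

@[simp]
theorem startsAt_inr_false (v : C.V) (r : C.R) : C.startsAt v (.inr r, false) = false := rfl

theorem sum_dirs_vertex {A : Type*} [AddCommMonoid A] (v : C.V) (h : C.Direction → A) :
    ∑ d ∈ C.dirs (.inl (.vertex v)), h d = ∑ e with C.src e = v, h (.inl e, true)
      + ∑ e with C.tgt e = v, h (.inl e, false) + ∑ r with C.root r = v, h (.inr r, true) := by
  simp only [dirs, Finset.sum_filter]
  rw [Fintype.sum_prod_type, Fintype.sum_sum_type]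
  simp only [Fintype.sum_bool, startsAt_inl_true, startsAt_inl_false, startsAt_inr_true,
    startsAt_inr_false, decide_eq_true_eq, Finset.sum_add_distrib, Bool.false_eq_true,
    if_false, add_zero]

theorem sum_dirs_edge {A : Type*} [AddCommMonoid A] {e : C.E} {t : ℝ}
    (ht : t ∈ Set.Ioo 0 (C.len e)) (h : C.Direction → A) :
    ∑ d ∈ C.dirs (.inl (C.edgePt e t)), h d = h (.inl e, true) + h (.inl e, false) := by
  rw [C.edgePt_of_mem ht]
  simp [dirs]

theorem sum_dirs_leaf {A : Type*} [AddCommMonoid A] {r : C.R} {t : ℝ} (ht : 0 < t)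
    (h : C.Direction → A) :
    ∑ d ∈ C.dirs (.inl (C.leafPt r t)), h d = h (.inr r, true) + h (.inr r, false) := by
  rw [C.leafPt_of_pos ht]
  simp [dirs]

theorem mem_dirs_edge_right {e : C.E} {t : ℝ} (ht : t ∈ Set.Ico 0 (C.len e)) :
    (Sum.inl e, true) ∈ C.dirs (.inl (C.edgePt e t)) := by
  rcases ht.1.eq_or_lt with rfl | h₀
  · simp [edgePt_zero, dirs]
  · simp [C.edgePt_of_mem ⟨h₀, ht.2⟩, dirs]

theorem mem_dirs_edge_left {e : C.E} {t : ℝ} (ht : t ∈ Set.Ioc 0 (C.len e)) :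
    (Sum.inl e, false) ∈ C.dirs (.inl (C.edgePt e t)) := by
  rcases ht.2.eq_or_lt with rfl | h₁
  · simp [edgePt_len, dirs]
  · simp [C.edgePt_of_mem ⟨ht.1, h₁⟩, dirs]

theorem mem_dirs_leaf_right {r : C.R} {t : ℝ} (ht : 0 ≤ t) :
    (Sum.inr r, true) ∈ C.dirs (.inl (C.leafPt r t)) := by
  rcases ht.eq_or_lt with rfl | h₀
  · simp [leafPt_zero, dirs]
  · simp [C.leafPt_of_pos h₀, dirs]

theorem mem_dirs_leaf_left {r : C.R} {t : ℝ} (ht : 0 < t) :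
    (Sum.inr r, false) ∈ C.dirs (.inl (C.leafPt r t)) := by
  simp [C.leafPt_of_pos ht, dirs]

variable {C}

theorem hasSlope_edge_right {f : C.FinPoint → ℝ} {e : C.E} {t : ℝ} (ht : t ∈ Set.Ico 0 (C.len e))
    (m : ℤ) : C.HasSlope f (.inl (C.edgePt e t)) (.inl e, true) m
      ↔ RightSlope (fun t => f (C.edgePt e t)) t m := by
  rcases ht.1.eq_or_lt with rfl | h₀
  · simp [edgePt_zero, HasSlope, RightSlope, move]
  · simp [C.edgePt_of_mem ⟨h₀, ht.2⟩, HasSlope, RightSlope, move]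

theorem hasSlope_edge_left {f : C.FinPoint → ℝ} {e : C.E} {t : ℝ} (ht : t ∈ Set.Ioc 0 (C.len e))
    (m : ℤ) : C.HasSlope f (.inl (C.edgePt e t)) (.inl e, false) m
      ↔ LeftSlope (fun t => f (C.edgePt e t)) t m := by
  rcases ht.2.eq_or_lt with rfl | h₁
  · simp [edgePt_len, HasSlope, LeftSlope, move]
  · simp [C.edgePt_of_mem ⟨ht.1, h₁⟩, HasSlope, LeftSlope, move]

theorem hasSlope_leaf_right {f : C.FinPoint → ℝ} {r : C.R} {t : ℝ} (ht : 0 ≤ t)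
    (m : ℤ) : C.HasSlope f (.inl (C.leafPt r t)) (.inr r, true) m
      ↔ RightSlope (fun t => f (C.leafPt r t)) t m := by
  rcases ht.eq_or_lt with rfl | h₀
  · simp [leafPt_zero, HasSlope, RightSlope, move]
  · simp [C.leafPt_of_pos h₀, HasSlope, RightSlope, move]

theorem hasSlope_leaf_left {f : C.FinPoint → ℝ} {r : C.R} {t : ℝ} (ht : 0 < t)
    (m : ℤ) : C.HasSlope f (.inl (C.leafPt r t)) (.inr r, false) m
      ↔ LeftSlope (fun t => f (C.leafPt r t)) t m := by
  simp [C.leafPt_of_pos ht, HasSlope, LeftSlope, move]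

/-- The slopes of a piecewise linear function, read on the edges and leaves. -/
theorem IsDivisorOf.exists_slopes {f : C.FinPoint → ℝ} {D : C.Divisor} (h : C.IsDivisorOf f D) :
    ∃ (ρ l : C.E → ℝ → ℤ) (σ : C.R → ℤ),
      (∀ e, ∀ t ∈ Set.Ico 0 (C.len e), RightSlope (fun t => f (C.edgePt e t)) t (ρ e t)) ∧
      (∀ e, ∀ t ∈ Set.Ioc 0 (C.len e), LeftSlope (fun t => f (C.edgePt e t)) t (l e t)) ∧
      (∀ e, ∀ t ∈ Set.Ioo 0 (C.len e), D (.inl (C.edgePt e t)) = ρ e t + l e t) ∧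
      (∀ r, ∃ S : Finset ℝ, (∀ t ∈ S, 0 < t) ∧
        (∀ t, 0 < t → D (.inl (C.leafPt r t)) ≠ 0 → t ∈ S) ∧
        D (.inr r) + ∑ t ∈ S, D (.inl (C.leafPt r t)) = -σ r) ∧
      ∀ v, D (.inl (.vertex v)) = ∑ e with C.src e = v, ρ e 0
        + ∑ e with C.tgt e = v, l e (C.len e) + ∑ r with C.root r = v, σ r := by
  choose m hm hD using h
  refine ⟨fun e t => m (.inl (C.edgePt e t)) (.inl e, true),
    fun e t => m (.inl (C.edgePt e t)) (.inl e, false),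
    fun r => m (.inl (C.leafPt r 0)) (.inr r, true),
    fun e t ht => (hasSlope_edge_right ht _).mp (hm _ _ (C.mem_dirs_edge_right ht)),
    fun e t ht => (hasSlope_edge_left ht _).mp (hm _ _ (C.mem_dirs_edge_left ht)),
    fun e t ht => (hD _).trans (C.sum_dirs_edge ht _), fun r => ?_, fun v => ?_⟩
  · let g : ℝ → ℝ := fun t => f (C.leafPt r t)
    let ρ : ℝ → ℤ := fun t => m (.inl (C.leafPt r t)) (.inr r, true)
    let l : ℝ → ℤ := fun t => m (.inl (C.leafPt r t)) (.inr r, false)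
    have hr : ∀ t, 0 ≤ t → RightSlope g t (ρ t) := fun t ht =>
      (hasSlope_leaf_right ht _).mp (hm _ _ (C.mem_dirs_leaf_right ht))
    have hl : ∀ t, 0 < t → LeftSlope g t (l t) := fun t ht =>
      (hasSlope_leaf_left ht _).mp (hm _ _ (C.mem_dirs_leaf_left ht))
    have hDt : ∀ t, 0 < t → D (.inl (C.leafPt r t)) = ρ t + l t := fun t ht =>
      (hD _).trans (C.sum_dirs_leaf ht _)
    have hDr : D (.inr r) = m (.inr r) (.inr r, false) := by
      rw [hD]
      simp [dirs]
    obtain ⟨a, ha⟩ : C.HasSlope f (.inr r) (.inr r, false) (D (.inr r)) := by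
      rw [hDr]
      exact hm _ _ (by simp [dirs])
    obtain ⟨b, hb⟩ := eventually_atTop.mp ha
    have hρ : ∀ t, 0 < t → b < t → ρ t = -D (.inr r) := by
      intro t h₀ ht
      refine slope_unique (hr t h₀.le) (eventually_nhdsGT_zero_iff.mpr ⟨1, one_pos, fun s hs _ => ?_⟩)
      simp only [g]
      rw [hb _ ht.le, hb _ (by linarith)]
      push_cast
      ring
    have hl' : ∀ t, 0 < t → b < t → l t = D (.inr r) := by
      intro t h₀ ht
      refine slope_unique (hl t h₀)
        (eventually_nhdsGT_zero_iff.mpr ⟨t - b, by linarith, fun s hs _ => ?_⟩)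
      simp only [g]
      rw [hb _ ht.le, hb _ (by linarith)]
      ring
    -- Beyond `b` the function is already affine, so all breaks on the leaf lie before this cutoff,
    -- where the slope is the one at infinity.
    have hc : 0 < max b 0 + 1 := by positivity
    have hbc : b < max b 0 + 1 := (le_max_left b 0).trans_lt (lt_add_one _)
    obtain ⟨S, hS, hS', hsum, -⟩ := hasBreakpoints hc (fun t ht => hr t ht.1) (fun t ht => hl t ht.1)
    refine ⟨S, fun t ht => (hS t ht).1, fun t h₀ h => ?_, ?_⟩
    · rw [hDt t h₀] at h
      rcases lt_or_ge t (max b 0 + 1) with h₁ | h₁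
      · exact hS' t ⟨h₀, h₁⟩ h
      · rw [hρ t h₀ (hbc.trans_le h₁), hl' t h₀ (hbc.trans_le h₁), neg_add_cancel] at h
        exact absurd rfl h
    · rw [Finset.sum_congr rfl fun t ht => hDt t (hS t ht).1, hsum, hl' _ hc hbc]
      ring
  · rw [hD, sum_dirs_vertex]
    congr 1
    · congr 1
      · exact Finset.sum_congr rfl fun e he => by
          beta_reduce
          rw [edgePt_zero, (Finset.mem_filter.mp he).2]
      · exact Finset.sum_congr rfl fun e he => by
          beta_reduce
          rw [edgePt_len, (Finset.mem_filter.mp he).2]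
    · exact Finset.sum_congr rfl fun e he => by
          beta_reduce
          rw [leafPt_zero, (Finset.mem_filter.mp he).2]

/-- The divergence theorem without twist: the increments of `f` along edges form a coboundary, which
vanishes on circuits, and only periods remain. -/
theorem degHom_and_jac_of_mem_principal {D : C.Divisor} (h : D ∈ C.principal) :
    C.degHom D = 0 ∧ C.jac (C.liftSum D) = 0 := by
  obtain ⟨f, hf⟩ := h
  obtain ⟨ρ, l, σ, hr, hl, hD, hleaf, hv⟩ := hf.exists_slopes
  obtain ⟨h₁, h₂⟩ := C.degHom_and_liftSum_eq D (fun e t => f (C.edgePt e t)) ρ l hr hl hD σ hleaf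
    (fun _ => 0) (by simpa using hv)
  refine ⟨by simpa using h₁, ?_⟩
  have h₃ : ∑ e, (f (C.edgePt e (C.len e)) - f (C.edgePt e 0)) • C.edgeFunctional e = 0 := by
    ext c
    have := C.sum_mul_coboundary c fun v => f (.vertex v)
    simp only [LinearMap.sum_apply, LinearMap.smul_apply, edgeFunctional_apply, edgePt_zero,
      edgePt_len, smul_eq_mul, LinearMap.zero_apply]
    rw [← this]
    exact Finset.sum_congr rfl fun e _ => mul_comm _ _
  simp only [zero_smul, add_zero, neg_smul, Finset.sum_sub_distrib, Finset.sum_neg_distrib, h₃,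
    neg_zero, zero_sub] at h₂
  rw [h₂, map_neg, map_sum]
  simp

variable (C)

/-! ### Abel's theorem -/

/-- A function on the edges is a coboundary if it is orthogonal to the circuits. -/
theorem exists_potential (h : C.E → ℝ) (hh : ∑ e, h e • C.edgeFunctional e = 0) :
    ∃ φ : C.V → ℝ, ∀ e, φ (C.tgt e) = φ (C.src e) + h e := by
  -- The potential is the sum of `h` along the chosen chain; orthogonality to `edgeCycle e` is the
  -- required increment along `e`.
  refine ⟨fun v => ∑ f, (C.chain v f : ℝ) * h f, fun e => ?_⟩
  have h₁ := congrArg (fun x : C.OmegaDual => x (C.edgeCycle e)) hh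
  simp only [LinearMap.sum_apply, LinearMap.smul_apply, edgeFunctional_apply, smul_eq_mul,
    LinearMap.zero_apply, edgeCycle_apply] at h₁
  have h₂ : ∑ f, h f * ((Pi.single e 1 : C.E → ℤ) f : ℝ) = h e := by
    simp [Pi.single_apply]
  push_cast at h₁
  simp only [mul_sub, mul_add, Finset.sum_sub_distrib, Finset.sum_add_distrib, h₂] at h₁
  simp only [mul_comm _ (h _)]
  linarith

/-- The function with prescribed values at the vertices, slopes at the sources of the edges and
the roots of the leaves, and break points inside the edges and leaves. -/
def bentFun (φ : C.V → ℝ) (n : C.E → ℤ) (σ : C.R → ℤ) (T : C.E → Finset ℝ) (S : C.R → Finset ℝ)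
    (D : C.Divisor) : C.FinPoint → ℝ
  | .vertex v => φ v
  | .onEdge e t _ _ => bent (φ (C.src e)) (n e) (T e) (fun t => D (.inl (C.edgePt e t))) t
  | .onLeaf r t _ => bent (φ (C.root r)) (σ r) (S r) (fun t => D (.inl (C.leafPt r t))) t

theorem isDivisorOf_bentFun {φ : C.V → ℝ} {n : C.E → ℤ} {σ : C.R → ℤ} {T : C.E → Finset ℝ}
    {S : C.R → Finset ℝ} {D : C.Divisor}
    (hT : ∀ e, ∀ t ∈ T e, t ∈ Set.Ioo 0 (C.len e))
    (hT' : ∀ e, ∀ t ∈ Set.Ioo 0 (C.len e), D (.inl (C.edgePt e t)) ≠ 0 → t ∈ T e)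
    (hS : ∀ r, ∀ t ∈ S r, 0 < t)
    (hS' : ∀ r t, 0 < t → D (.inl (C.leafPt r t)) ≠ 0 → t ∈ S r)
    (hφ : ∀ e, φ (C.tgt e) = bent (φ (C.src e)) (n e) (T e) (fun t => D (.inl (C.edgePt e t)))
      (C.len e))
    (hσ : ∀ r, D (.inr r) + ∑ t ∈ S r, D (.inl (C.leafPt r t)) = -σ r)
    (hv : ∀ v, D (.inl (.vertex v)) = ∑ e with C.src e = v, n e
      + ∑ e with C.tgt e = v, (-n e - ∑ t ∈ T e, D (.inl (C.edgePt e t)))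
      + ∑ r with C.root r = v, σ r) :
    C.IsDivisorOf (C.bentFun φ n σ T S D) D := by
  set f := C.bentFun φ n σ T S D with hf
  set k : C.E → ℝ → ℤ := fun e t => D (.inl (C.edgePt e t)) with hk
  set k' : C.R → ℝ → ℤ := fun r t => D (.inl (C.leafPt r t)) with hk'
  have hfe : ∀ e, ∀ t ∈ Set.Icc 0 (C.len e),
      f (C.edgePt e t) = bent (φ (C.src e)) (n e) (T e) (k e) t := by
    intro e t ht
    rcases ht.1.eq_or_lt with rfl | h₀
    · rw [edgePt_zero, bent_of_le fun u hu => (hT e u hu).1.le, mul_zero, add_zero]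
      rfl
    rcases ht.2.eq_or_lt with rfl | h₁
    · rw [edgePt_len]
      exact hφ e
    · rw [C.edgePt_of_mem ⟨h₀, h₁⟩]
      rfl
  have hfr : ∀ r t, 0 ≤ t → f (C.leafPt r t) = bent (φ (C.root r)) (σ r) (S r) (k' r) t := by
    intro r t ht
    rcases ht.eq_or_lt with rfl | h₀
    · rw [leafPt_zero, bent_of_le fun u hu => (hS r u hu).le, mul_zero, add_zero]
      rfl
    · rw [C.leafPt_of_pos h₀]
      rfl
  have hedge_r : ∀ e, ∀ t ∈ Set.Ico 0 (C.len e), C.HasSlope f (.inl (C.edgePt e t)) (.inl e, true)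
      (n e + ∑ u ∈ T e, k e u * if u ≤ t then 1 else 0) := fun e t ht =>
    (hasSlope_edge_right ht _).mpr <| (rightSlope_bent _ _ _ _ t).congr ht.2 fun s hs =>
      hfe e s ⟨ht.1.trans hs.1, hs.2.le⟩
  have hedge_l : ∀ e, ∀ t ∈ Set.Ioc 0 (C.len e), C.HasSlope f (.inl (C.edgePt e t)) (.inl e, false)
      (-n e + ∑ u ∈ T e, k e u * if u < t then -1 else 0) := fun e t ht =>
    (hasSlope_edge_left ht _).mpr <| (leftSlope_bent _ _ _ _ t).congr ht.1 fun s hs =>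
      hfe e s ⟨hs.1.le, hs.2.trans ht.2⟩
  have hleaf_r : ∀ r t, 0 ≤ t → C.HasSlope f (.inl (C.leafPt r t)) (.inr r, true)
      (σ r + ∑ u ∈ S r, k' r u * if u ≤ t then 1 else 0) := fun r t ht =>
    (hasSlope_leaf_right ht _).mpr <| (rightSlope_bent _ _ _ _ t).congr (lt_add_one t) fun s hs =>
      hfr r s (ht.trans hs.1)
  have hleaf_l : ∀ r t, 0 < t → C.HasSlope f (.inl (C.leafPt r t)) (.inr r, false)
      (-σ r + ∑ u ∈ S r, k' r u * if u < t then -1 else 0) := fun r t ht =>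
    (hasSlope_leaf_left ht _).mpr <| (leftSlope_bent _ _ _ _ t).congr ht fun s hs =>
      hfr r s hs.1.le
  have hedge₀ : ∀ e, C.HasSlope f (.inl (.vertex (C.src e))) (.inl e, true) (n e) := by
    intro e
    have h := hedge_r e 0 ⟨le_rfl, C.len_pos e⟩
    rwa [edgePt_zero, Finset.sum_eq_zero fun u hu => by
      rw [if_neg (not_le.mpr (hT e u hu).1), mul_zero], add_zero] at h
  have hedge₁ : ∀ e, C.HasSlope f (.inl (.vertex (C.tgt e))) (.inl e, false)
      (-n e - ∑ t ∈ T e, k e t) := by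
    intro e
    have h := hedge_l e (C.len e) ⟨C.len_pos e, le_rfl⟩
    rwa [edgePt_len, Finset.sum_congr rfl fun u hu => by
      rw [if_pos (hT e u hu).2, mul_neg_one], Finset.sum_neg_distrib, ← sub_eq_add_neg] at h
  have hleaf₀ : ∀ r, C.HasSlope f (.inl (.vertex (C.root r))) (.inr r, true) (σ r) := by
    intro r
    have h := hleaf_r r 0 le_rfl
    rwa [leafPt_zero, Finset.sum_eq_zero fun u hu => by
      rw [if_neg (not_le.mpr (hS r u hu)), mul_zero], add_zero] at h
  have hpair : ∀ (m : C.Direction → ℤ) (x : C.E ⊕ C.R),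
      ∑ d ∈ ({(x, true), (x, false)} : Finset C.Direction), m d = m (x, true) + m (x, false) :=
    fun m x => Finset.sum_pair (by simp)
  rintro ((v | ⟨e, t, h₀, h₁⟩ | ⟨r, t, h₀⟩) | r)
  · refine ⟨fun d => match d with
      | (.inl e, true) => n e
      | (.inl e, false) => -n e - ∑ t ∈ T e, k e t
      | (.inr r, _) => σ r, ?_, ?_⟩
    · rintro ⟨e | r, _ | _⟩ hd <;> simp only [dirs, Finset.mem_filter, Finset.mem_univ, true_and,
        startsAt_inl_true, startsAt_inl_false, startsAt_inr_true, startsAt_inr_false,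
        decide_eq_true_eq, Bool.false_eq_true] at hd
      · rw [← hd]
        exact hedge₁ e
      · rw [← hd]
        exact hedge₀ e
      · rw [← hd]
        exact hleaf₀ r
    · rw [sum_dirs_vertex]
      exact hv v
  · have hp := C.edgePt_of_mem (e := e) ⟨h₀, h₁⟩
    refine ⟨fun d => if d.2 then n e + ∑ u ∈ T e, k e u * (if u ≤ t then 1 else 0)
      else -n e + ∑ u ∈ T e, k e u * if u < t then -1 else 0, ?_, ?_⟩
    · intro d hd
      rw [← hp]
      simp only [dirs, Finset.mem_insert, Finset.mem_singleton] at hd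
      rcases hd with rfl | rfl
      · exact hedge_r e t ⟨h₀.le, h₁⟩
      · exact hedge_l e t ⟨h₀, h₁.le⟩
    · rw [dirs, hpair]
      simp only [if_true, Bool.false_eq_true, if_false]
      rw [bent_jump _ _ _ _ fun ht => by_contra fun h => ht (hT' e t ⟨h₀, h₁⟩ h), hk]
      simp only [hp]
  · have hp := C.leafPt_of_pos (r := r) h₀
    refine ⟨fun d => if d.2 then σ r + ∑ u ∈ S r, k' r u * (if u ≤ t then 1 else 0)
      else -σ r + ∑ u ∈ S r, k' r u * if u < t then -1 else 0, ?_, ?_⟩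
    · intro d hd
      rw [← hp]
      simp only [dirs, Finset.mem_insert, Finset.mem_singleton] at hd
      rcases hd with rfl | rfl
      · exact hleaf_r r t h₀.le
      · exact hleaf_l r t h₀
    · rw [dirs, hpair]
      simp only [if_true, Bool.false_eq_true, if_false]
      rw [bent_jump _ _ _ _ fun ht => by_contra fun h => ht (hS' r t h₀ h), hk']
      simp only [hp]
  · refine ⟨fun _ => D (.inr r), ?_, by simp [dirs]⟩
    intro d _
    obtain ⟨M, hM⟩ := (S r).exists_le
    refine ⟨φ (C.root r) - ∑ u ∈ S r, k' r u * u, eventually_atTop.mpr ⟨max M 0, fun s hs => ?_⟩⟩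
    rw [hfr r s ((le_max_right _ _).trans hs),
      bent_of_ge fun u hu => (hM u hu).trans ((le_max_left _ _).trans hs)]
    have : σ r + ∑ u ∈ S r, k' r u = -D (.inr r) := by
      have := hσ r
      linarith
    rw [this]
    push_cast
    ring

variable {C}

/-- Degree 0 allows slopes that satisfy the divisor condition at all vertices. The resulting edge
functions need not glue; vanishing in the Jacobian says that the obstruction is a period, and
changing the slopes by that cycle removes it. -/
theorem mem_principal_of_jac {D : C.Divisor} (hdeg : C.degHom D = 0)
    (hjac : C.jac (C.liftSum D) = 0) : D ∈ C.principal := by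
  choose T hT hT' using C.exists_finset_edge D
  choose S hS hS' using C.exists_finset_leaf D
  let k : C.E → ℝ → ℤ := fun e t => D (.inl (C.edgePt e t))
  let σ : C.R → ℤ := fun r => -(D (.inr r) + ∑ t ∈ S r, D (.inl (C.leafPt r t)))
  have hσ : ∀ r, D (.inr r) + ∑ t ∈ S r, D (.inl (C.leafPt r t)) = -σ r := fun r =>
    (neg_neg _).symm
  -- The slopes `n` at the sources of the edges satisfy the condition at the vertices when `∂n =
  -- -B`, which is solvable because the total of `B` is the degree.
  let B : C.V → ℤ := fun v => D (.inl (.vertex v)) + ∑ e with C.tgt e = v, ∑ t ∈ T e, k e t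
    - ∑ r with C.root r = v, σ r
  have hB : ∑ v, B v = 0 := by
    rw [← hdeg, ← deg_eq, deg, C.sum_eq D T S hT hS hT' hS' _ fun _ => rfl]
    simp only [B, Finset.sum_sub_distrib, Finset.sum_add_distrib, hσ]
    rw [Fintype.sum_sum_fiber C.tgt fun e _ => ∑ t ∈ T e, k e t,
      Fintype.sum_sum_fiber C.root fun r _ => σ r, sub_eq_add_neg, ← Finset.sum_neg_distrib]
  let n₀ : C.E → ℤ := -∑ v, B v • C.chain v
  have hn₀ : C.boundary n₀ = -B := by
    have h : ∑ v, B v • (Pi.single C.baseVertex 1 : C.V → ℤ) = 0 := by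
      rw [← Finset.sum_smul, hB, zero_smul]
    simp only [n₀, map_neg, map_sum, map_smul, boundary_chain, smul_sub, Finset.sum_sub_distrib, h,
      sub_zero, neg_inj]
    ext v
    simp [Pi.single_apply]
  have hvert : ∀ n : C.E → ℤ, C.boundary n = -B → ∀ v, D (.inl (.vertex v))
      = ∑ e with C.src e = v, n e + ∑ e with C.tgt e = v, (-n e - ∑ t ∈ T e, k e t)
        + ∑ r with C.root r = v, σ r := by
    intro n hn v
    have := congrFun hn v
    simp only [boundary_apply, Pi.neg_apply, B] at this
    simp only [Finset.sum_sub_distrib, Finset.sum_neg_distrib]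
    linarith
  have hT₀ : ∀ e, (∑ u ∈ T e, k e u * if u ≤ 0 then 1 else 0) = 0 := fun e =>
    Finset.sum_eq_zero fun u hu => by rw [if_neg (not_le.mpr (hT e u hu).1), mul_zero]
  have hT₁ : ∀ e, (∑ u ∈ T e, k e u * if u < C.len e then -1 else 0) = -∑ u ∈ T e, k e u :=
    fun e => by
      rw [Finset.sum_congr rfl fun u hu => by rw [if_pos (hT e u hu).2, mul_neg_one],
        Finset.sum_neg_distrib]
  have hflux := (C.degHom_and_liftSum_eq D (fun e => bent 0 (n₀ e) (T e) (k e))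
    (fun e t => n₀ e + ∑ u ∈ T e, k e u * if u ≤ t then 1 else 0)
    (fun e t => -n₀ e + ∑ u ∈ T e, k e u * if u < t then -1 else 0)
    (fun e t _ => rightSlope_bent _ _ _ _ t) (fun e t _ => leftSlope_bent _ _ _ _ t)
    (fun e t ht => (bent_jump (n₀ e) (T e) (k e) t fun h' =>
      by_contra fun h => h' (hT' e t ht h)).symm)
    σ (fun r => ⟨S r, hS r, hS' r, hσ r⟩) (fun _ => 0) (fun v => by
      rw [hvert n₀ hn₀ v]
      simp only [hT₀, hT₁, add_zero, sub_eq_add_neg])).2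
  simp only [zero_smul, add_zero, neg_smul, Finset.sum_sub_distrib, Finset.sum_neg_distrib] at hflux
  rw [hflux, map_sub, map_neg, map_sum C.jac (fun e => _ • C.cycleIntegral _)] at hjac
  simp only [map_zsmul, jac_cycleIntegral, smul_zero, Finset.sum_const_zero, sub_zero,
    neg_eq_zero] at hjac
  obtain ⟨c, hc⟩ := jac_eq_zero_iff.mp hjac
  -- The increments after subtracting the cycle `c` from the slopes; they are orthogonal to the
  -- circuits, hence come from values at the vertices.
  let g : C.E → ℝ := fun e => bent 0 (n₀ e) (T e) (k e) (C.len e) - c.1 e * C.len e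
  obtain ⟨φ, hφ⟩ := C.exists_potential g (by
    have h₀ : ∀ e, bent 0 (n₀ e) (T e) (k e) 0 = 0 := fun e => by
      rw [bent_of_le fun u hu => (hT e u hu).1.le, mul_zero, add_zero]
    simp only [g, sub_smul, Finset.sum_sub_distrib]
    simp only [h₀, sub_zero] at hc
    rw [← hc]
    exact sub_self _)
  refine ⟨_, C.isDivisorOf_bentFun (φ := φ) (n := n₀ - c.1) hT hT' hS hS' (fun e => ?_) hσ
    (hvert _ (by rw [map_sub, mem_circuits_iff.mp c.2, sub_zero, hn₀]))⟩
  rw [hφ e]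
  simp only [g, bent, Pi.sub_apply, Int.cast_sub]
  ring

theorem mem_principal_iff {D : C.Divisor} :
    D ∈ C.principal ↔ C.degHom D = 0 ∧ C.jac (C.liftSum D) = 0 :=
  ⟨degHom_and_jac_of_mem_principal, fun h => mem_principal_of_jac h.1 h.2⟩

/-! ### A non-effective theta characteristic -/

variable (C) in
/-- The sum of the midpoints of the bounded edges minus the sum of the vertices. -/
def midDivisor : C.Divisor :=
  ∑ e, Finsupp.single (.inl (C.edgePt e (C.len e / 2))) 1 - ∑ v, Finsupp.single (.inl (.vertex v)) 1

theorem half_len_mem (e : C.E) : C.len e / 2 ∈ Set.Ioo 0 (C.len e) :=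
  ⟨half_pos (C.len_pos e), half_lt_self (C.len_pos e)⟩

theorem midDivisor_vertex (v : C.V) : C.midDivisor (.inl (.vertex v)) = -1 := by
  classical
  simp [midDivisor, Finsupp.single_apply, C.edgePt_of_mem (half_len_mem _)]

theorem midDivisor_edge {e : C.E} {t : ℝ} (ht : t ∈ Set.Ioo 0 (C.len e)) :
    C.midDivisor (.inl (C.edgePt e t)) = if t = C.len e / 2 then 1 else 0 := by
  classical
  simp only [midDivisor, Finsupp.sub_apply, Finsupp.finsetSum_apply, Finsupp.single_apply,
    C.edgePt_of_mem (half_len_mem _), C.edgePt_of_mem ht]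
  simp only [Sum.inl.injEq, FinPoint.onEdge.injEq, reduceCtorEq, if_false, Finset.sum_const_zero,
    sub_zero]
  rw [Finset.sum_eq_single e]
  · simp [eq_comm]
  · intro b _ hb
    simp [hb]
  · simp

theorem midDivisor_leaf {r : C.R} {t : ℝ} (ht : 0 < t) :
    C.midDivisor (.inl (C.leafPt r t)) = 0 := by
  classical
  simp [midDivisor, C.edgePt_of_mem (half_len_mem _), C.leafPt_of_pos ht]

theorem midDivisor_end (r : C.R) : C.midDivisor (.inr r) = 0 := by
  classical
  simp [midDivisor]

theorem degHom_midDivisor : C.degHom C.midDivisor = C.genus - 1 := by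
  rw [midDivisor, map_sub, map_sum, map_sum, genus_eq]
  simp

/-- Maximum principle. At a vertex `v` where `f` is largest among the vertices, the divisor is at
least 1, so some outward slope is positive. It is not along a leaf, where `f` can only bend upwards
and has nonnegative divisor at infinity. Along an edge the only downward bend is at most 1, at the
midpoint, and costs half the length, so slope at least 1 would make `f` larger at the other end. -/
theorem sub_midDivisor_notMem_principal {D : C.Divisor} (hD : 0 ≤ D) :
    D - C.midDivisor ∉ C.principal := by
  rintro ⟨f, hf⟩
  obtain ⟨ρ, l, σ, hr, hl, hedge, hleaf, hv⟩ := hf.exists_slopes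
  have hD' : ∀ p, 0 ≤ D p := fun p => hD p
  have := C.nonempty
  obtain ⟨v, hmax⟩ := Finite.exists_max fun v : C.V => f (.vertex v)
  have hσ : ∀ r, σ r ≤ 0 := by
    intro r
    obtain ⟨S, hS, -, hsum⟩ := hleaf r
    have h₁ : 0 ≤ ∑ t ∈ S, (D - C.midDivisor) (.inl (C.leafPt r t)) :=
      Finset.sum_nonneg fun t ht => by
        rw [Finsupp.sub_apply, midDivisor_leaf (hS t ht), sub_zero]
        exact hD' _
    have h₂ : 0 ≤ (D - C.midDivisor) (.inr r) := by
      rw [Finsupp.sub_apply, midDivisor_end, sub_zero]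
      exact hD' _
    linarith
  have hjump : ∀ e, ∀ t ∈ Set.Ioo 0 (C.len e), ∀ x : ℝ, 0 ≤ x →
      (if t = C.len e / 2 then -x else 0) ≤ ((ρ e t + l e t : ℤ) : ℝ) * x := by
    intro e t ht x hx
    rw [← hedge e t ht, Finsupp.sub_apply, midDivisor_edge ht]
    have : (0 : ℝ) ≤ D (.inl (C.edgePt e t)) := by exact_mod_cast hD' _
    split_ifs
    · push_cast
      nlinarith
    · push_cast
      nlinarith
  have hsum : ∀ e, ∀ T : Finset ℝ, -(C.len e / 2) ≤
      ∑ t ∈ T, (if t = C.len e / 2 then -(C.len e / 2) else 0) := by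
    intro e T
    rw [Finset.sum_ite_eq' T (C.len e / 2)]
    have := C.len_pos e
    split_ifs <;> linarith
  have hslopes : ∀ e, f (.vertex (C.src e)) + C.len e * (ρ e 0 : ℝ) - C.len e / 2
        ≤ f (.vertex (C.tgt e)) ∧
      f (.vertex (C.tgt e)) + C.len e * (l e (C.len e) : ℝ) - C.len e / 2
        ≤ f (.vertex (C.src e)) := by
    intro e
    obtain ⟨T, hT, -, h₁, h₂⟩ := hasBreakpoints (C.len_pos e) (hr e) (hl e)
    beta_reduce at h₂
    rw [edgePt_zero, edgePt_len] at h₂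
    have h₁' : ∑ t ∈ T, ((ρ e t + l e t : ℤ) : ℝ) = -(l e (C.len e)) - ρ e 0 := by
      exact_mod_cast h₁
    constructor
    -- A bend at `t` changes the value at the far end by the jump times `len e - t`.
    · have h₃ : ∑ t ∈ T, (if t = C.len e / 2 then -(C.len e / 2) else 0)
          ≤ ∑ t ∈ T, ((ρ e t + l e t : ℤ) : ℝ) * (C.len e - t) := by
        refine Finset.sum_le_sum fun t ht => ?_
        refine le_trans (le_of_eq ?_) (hjump e t (hT t ht) (C.len e - t) (by linarith [(hT t ht).2]))
        split_ifs with h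
        · rw [h]; ring
        · rfl
      simp only [mul_sub, Finset.sum_sub_distrib, ← Finset.sum_mul] at h₃
      rw [h₁', h₂] at h₃
      linarith [hsum e T]
    · have h₃ : ∑ t ∈ T, (if t = C.len e / 2 then -(C.len e / 2) else 0)
          ≤ ∑ t ∈ T, ((ρ e t + l e t : ℤ) : ℝ) * t := by
        refine Finset.sum_le_sum fun t ht => ?_
        refine le_trans (le_of_eq ?_) (hjump e t (hT t ht) t (hT t ht).1.le)
        split_ifs with h
        · rw [h]
        · rfl
      rw [h₂] at h₃
      linarith [hsum e T]
  have hnonpos : ∀ (L : ℝ) (m : ℤ), 0 < L → L * (m : ℝ) - L / 2 ≤ 0 → m ≤ 0 := by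
    intro L m hL h
    by_contra! hm
    have : (1 : ℝ) ≤ m := by exact_mod_cast hm
    nlinarith
  have h := hv v
  rw [Finsupp.sub_apply, midDivisor_vertex] at h
  have h₁ : ∑ e with C.src e = v, ρ e 0 ≤ 0 := Finset.sum_nonpos fun e he => by
    have := hslopes e
    have h' := hmax (C.tgt e)
    rw [(Finset.mem_filter.mp he).2] at this
    exact hnonpos _ _ (C.len_pos e) (by linarith [this.1])
  have h₂ : ∑ e with C.tgt e = v, l e (C.len e) ≤ 0 := Finset.sum_nonpos fun e he => by
    have := hslopes e
    have h' := hmax (C.src e)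
    rw [(Finset.mem_filter.mp he).2] at this
    exact hnonpos _ _ (C.len_pos e) (by linarith [this.2])
  have h₃ : ∑ r with C.root r = v, σ r ≤ 0 := Finset.sum_nonpos fun r _ => hσ r
  linarith [hD' (.inl (.vertex v))]

variable (C)

/-! ### The tropical theta function -/

/-- The affine functions of which the theta function is the maximum. -/
def thetaTerm (c : C.circuits) (x : C.OmegaDual) : ℝ :=
  C.Q c x - 1 / 2 * C.Q c (C.cycleIntegral c)

variable {C}

/-- The values on edge cycles serve as coordinates of a functional: they write `thetaTerm` as a sum
over edges and define the boxes on which maxima are controlled. -/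
theorem OmegaDual.apply_eq (x : C.OmegaDual) (c : C.circuits) :
    x c = ∑ e, (c.1 e : ℝ) * x (C.edgeCycle e) := by
  conv_lhs => rw [← C.sum_smul_edgeCycle c, map_sum]
  exact Finset.sum_congr rfl fun e _ => by rw [map_zsmul, zsmul_eq_mul]

theorem thetaTerm_eq (c : C.circuits) (x : C.OmegaDual) :
    C.thetaTerm c x
      = ∑ e, ((c.1 e : ℝ) * x (C.edgeCycle e) - 1 / 2 * C.len e * (c.1 e : ℝ) ^ 2) := by
  rw [thetaTerm, Q_cycleIntegral, Q, OmegaDual.apply_eq, Finset.mul_sum, ← Finset.sum_sub_distrib]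
  exact Finset.sum_congr rfl fun e _ => by ring

theorem thetaTerm_zero (x : C.OmegaDual) : C.thetaTerm 0 x = 0 := by
  rw [thetaTerm_eq]
  simp

theorem thetaTerm_add_smul (c : C.circuits) (x τ : C.OmegaDual) (s : ℝ) :
    C.thetaTerm c (x + s • τ) = C.thetaTerm c x + s * τ c := by
  simp only [thetaTerm, Q, LinearMap.add_apply, LinearMap.smul_apply, smul_eq_mul]
  ring

/-- Each edge contributes a concave quadratic in `c e`, bounded above by `H ^ 2 / (2 * len e)`. If
the sum is nonnegative, no single contribution can be very negative, which bounds every coefficient.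
-/
theorem finite_setOf_thetaTerm_nonneg (H : ℝ) (hH : 0 ≤ H) :
    {c : C.circuits | ∃ x : C.OmegaDual, (∀ e, |x (C.edgeCycle e)| ≤ H) ∧
      0 ≤ C.thetaTerm c x}.Finite := by
  set B : ℝ := ∑ e, H ^ 2 / (2 * C.len e) with hB
  have hB₀ : ∀ e, 0 ≤ H ^ 2 / (2 * C.len e) := fun e => by
    have := C.len_pos e
    positivity
  have hB' : 0 ≤ B := Finset.sum_nonneg fun e _ => hB₀ e
  let N : C.E → ℤ := fun e => ⌈(2 * H + 2 * B) / C.len e + 1⌉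
  have hfin : (Set.univ.pi fun e => Set.Icc (-N e) (N e)).Finite :=
    Set.Finite.pi fun e => Set.finite_Icc _ _
  refine Set.Finite.of_finite_image (f := Subtype.val) (hfin.subset ?_)
    Subtype.val_injective.injOn
  rintro _ ⟨c, ⟨x, hx, h⟩, rfl⟩ e -
  change c.1 e ∈ Set.Icc (-N e) (N e)
  rw [Set.mem_Icc, ← abs_le]
  suffices hK : |(c.1 e : ℝ)| ≤ (2 * H + 2 * B) / C.len e + 1 by
    have : ((|c.1 e| : ℤ) : ℝ) ≤ N e := by
      push_cast
      exact hK.trans (Int.le_ceil _)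
    exact_mod_cast this
  have hterm : ∀ f, (c.1 f : ℝ) * x (C.edgeCycle f) ≤ |(c.1 f : ℝ)| * H := fun f =>
    (le_abs_self _).trans (by
      rw [abs_mul]
      exact mul_le_mul_of_nonneg_left (hx f) (abs_nonneg _))
  have hmax : ∀ f, (c.1 f : ℝ) * x (C.edgeCycle f) - 1 / 2 * C.len f * (c.1 f : ℝ) ^ 2
      ≤ H ^ 2 / (2 * C.len f) := by
    intro f
    have hL := C.len_pos f
    rw [le_div_iff₀ (by positivity)]
    have := hterm f
    rw [← sq_abs (c.1 f : ℝ)]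
    nlinarith [sq_nonneg (C.len f * |(c.1 f : ℝ)| - H), mul_le_mul_of_nonneg_left this hL.le]
  rw [thetaTerm_eq, ← Finset.add_sum_erase _ _ (Finset.mem_univ e)] at h
  have hrest : ∑ f ∈ Finset.univ.erase e,
      ((c.1 f : ℝ) * x (C.edgeCycle f) - 1 / 2 * C.len f * (c.1 f : ℝ) ^ 2) ≤ B :=
    (Finset.sum_le_sum fun f _ => hmax f).trans
      (Finset.sum_le_sum_of_subset_of_nonneg (Finset.erase_subset _ _) fun f _ _ => hB₀ f)
  have hkey : 1 / 2 * C.len e * |(c.1 e : ℝ)| ^ 2 ≤ |(c.1 e : ℝ)| * H + B := by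
    rw [sq_abs]
    linarith [hterm e]
  by_contra! hlt
  have hL := C.len_pos e
  set a := |(c.1 e : ℝ)|
  have h₁ : 1 < a := lt_of_le_of_lt (by
    have : 0 ≤ (2 * H + 2 * B) / C.len e := by positivity
    linarith) hlt
  have h₂ : 2 * H + 2 * B < C.len e * a := by
    have : (2 * H + 2 * B) / C.len e < a := by linarith
    linarith [(div_lt_iff₀ hL).mp this]
  nlinarith [mul_lt_mul_of_pos_right h₂ (zero_lt_one.trans h₁), mul_le_mul_of_nonneg_left h₁.le hB']

/-- The zero cycle has term 0, so only nonnegative terms compete: on a box the supremum is a maximum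
over one finite set. -/
theorem exists_finset_theta (H : ℝ) (hH : 0 ≤ H) :
    ∃ S : Finset C.circuits, ∀ x : C.OmegaDual, (∀ e, |x (C.edgeCycle e)| ≤ H) →
      (∃ c ∈ S, C.theta x = C.thetaTerm c x) ∧ (∀ c, C.thetaTerm c x ≤ C.theta x) ∧
      ∀ c, C.thetaTerm c x = C.theta x → c ∈ S := by
  have hfin := C.finite_setOf_thetaTerm_nonneg H hH
  have h₀ : (0 : C.circuits) ∈ hfin.toFinset :=
    hfin.mem_toFinset.mpr ⟨0, fun e => by simpa using hH, (thetaTerm_zero _).ge⟩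
  refine ⟨hfin.toFinset, fun x hx => ?_⟩
  obtain ⟨c₀, hc₀, hmax⟩ := hfin.toFinset.exists_max_image (C.thetaTerm · x) ⟨0, h₀⟩
  have hle : ∀ c, C.thetaTerm c x ≤ C.thetaTerm c₀ x := by
    intro c
    by_cases hc : c ∈ hfin.toFinset
    · exact hmax c hc
    · refine le_trans ?_ (hmax 0 h₀)
      rw [thetaTerm_zero]
      by_contra! h
      exact hc (hfin.mem_toFinset.mpr ⟨x, hx, h.le⟩)
  have heq : C.theta x = C.thetaTerm c₀ x :=
    le_antisymm (ciSup_le hle) (le_ciSup (f := fun c => C.thetaTerm c x)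
      ⟨_, by rintro _ ⟨c, rfl⟩; exact hle c⟩ c₀)
  refine ⟨⟨c₀, hc₀, heq⟩, fun c => heq ▸ hle c, fun c hc => hfin.mem_toFinset.mpr ⟨x, hx, ?_⟩⟩
  rw [hc, heq, ← thetaTerm_zero x]
  exact hle 0

theorem abs_le_sum_abs (x : C.OmegaDual) (e : C.E) :
    |x (C.edgeCycle e)| ≤ ∑ f, |x (C.edgeCycle f)| :=
  Finset.single_le_sum (f := fun f => |x (C.edgeCycle f)|) (fun _ _ => abs_nonneg _)
    (Finset.mem_univ e)

theorem exists_thetaTerm_eq (x : C.OmegaDual) : ∃ c, C.thetaTerm c x = C.theta x := by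
  obtain ⟨S, hS⟩ := C.exists_finset_theta (∑ f, |x (C.edgeCycle f)|)
    (Finset.sum_nonneg fun _ _ => abs_nonneg _)
  obtain ⟨c, -, hc⟩ := (hS x (abs_le_sum_abs x)).1
  exact ⟨c, hc.symm⟩

theorem thetaTerm_le_theta (c : C.circuits) (x : C.OmegaDual) : C.thetaTerm c x ≤ C.theta x := by
  obtain ⟨S, hS⟩ := C.exists_finset_theta (∑ f, |x (C.edgeCycle f)|)
    (Finset.sum_nonneg fun _ _ => abs_nonneg _)
  exact (hS x (abs_le_sum_abs x)).2.1 c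

/-- Along a ray with integral velocity, the theta function is linear near the origin of the ray,
with slope the maximal one among the terms which attain the maximum there. -/
theorem exists_theta_germ (x τ : C.OmegaDual) (n : C.circuits → ℤ) (hτ : ∀ c, τ c = n c) :
    ∃ c₀, (∀ c, C.thetaTerm c x = C.theta x → n c ≤ n c₀) ∧
      ∀ᶠ s : ℝ in 𝓝[>] 0, C.theta (x + s • τ) = C.theta x + n c₀ * s := by
  obtain ⟨S, hS⟩ := C.exists_finset_theta
    (∑ f, |x (C.edgeCycle f)| + ∑ f, |τ (C.edgeCycle f)|)
    (add_nonneg (Finset.sum_nonneg fun _ _ => abs_nonneg _)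
      (Finset.sum_nonneg fun _ _ => abs_nonneg _))
  have hbox : ∀ s : ℝ, 0 ≤ s → s < 1 → ∀ e, |(x + s • τ) (C.edgeCycle e)|
      ≤ ∑ f, |x (C.edgeCycle f)| + ∑ f, |τ (C.edgeCycle f)| := by
    intro s h₀ h₁ e
    rw [LinearMap.add_apply, LinearMap.smul_apply, smul_eq_mul]
    refine (abs_add_le _ _).trans (add_le_add (abs_le_sum_abs x e) ?_)
    rw [abs_mul, abs_of_nonneg h₀]
    exact (mul_le_of_le_one_left (abs_nonneg _) h₁.le).trans (abs_le_sum_abs τ e)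
  have hbox₀ := hbox 0 le_rfl one_pos
  rw [zero_smul, add_zero] at hbox₀
  obtain ⟨⟨c₁, hc₁, hc₁'⟩, hle, hmem⟩ := hS x hbox₀
  classical
  obtain ⟨c₀, hc₀, hmax⟩ := (S.filter fun c => C.thetaTerm c x = C.theta x).exists_max_image n
    ⟨c₁, Finset.mem_filter.mpr ⟨hc₁, hc₁'.symm⟩⟩
  have hn : ∀ c, C.thetaTerm c x = C.theta x → n c ≤ n c₀ := fun c hc =>
    hmax c (Finset.mem_filter.mpr ⟨hmem c hc, hc⟩)
  have hx₀ := (Finset.mem_filter.mp hc₀).2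
  refine ⟨c₀, hn, ?_⟩
  -- Terms below the maximum at `x` stay below by continuity; those attaining it are compared by
  -- slope.
  have hlt : ∀ᶠ s : ℝ in 𝓝[>] 0, ∀ c ∈ S,
      C.thetaTerm c x + s * n c ≤ C.thetaTerm c₀ x + s * n c₀ := by
    refine (Finset.eventually_all S).mpr fun c _ => ?_
    rcases (hle c).eq_or_lt with h | h
    · filter_upwards [self_mem_nhdsWithin] with s hs
      have : (n c : ℝ) ≤ n c₀ := by exact_mod_cast hn c h
      rw [h, hx₀]
      have := mul_le_mul_of_nonneg_left this (le_of_lt hs)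
      linarith
    · refine nhdsWithin_le_nhds ?_
      have : ∀ᶠ s : ℝ in 𝓝 0, C.thetaTerm c x + s * n c < C.thetaTerm c₀ x + s * n c₀ :=
        ContinuousAt.eventually_lt (by fun_prop) (by fun_prop) (by simpa [hx₀] using h)
      exact this.mono fun s hs => hs.le
  have hs₁ : ∀ᶠ s : ℝ in 𝓝[>] 0, 0 < s ∧ s < 1 :=
    eventually_nhdsGT_zero_iff.mpr ⟨1, one_pos, fun s h₀ h₁ => ⟨h₀, h₁⟩⟩
  filter_upwards [hlt, hs₁] with s hs hs₁
  obtain ⟨⟨c, hc, hc'⟩, hle', -⟩ := hS _ (hbox s hs₁.1.le hs₁.2)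
  have h₂ := hle' c₀
  have h₃ := hs c hc
  rw [thetaTerm_add_smul, hτ] at hc' h₂
  rw [hx₀] at h₂ h₃
  linarith

theorem thetaTerm_add_cycleIntegral (c b : C.circuits) (x : C.OmegaDual) :
    C.thetaTerm c (x + C.cycleIntegral b)
      = C.thetaTerm (c - b) x + x b + 1 / 2 * C.Q b (C.cycleIntegral b) := by
  have h₁ : x (c - b) = x c - x b := map_sub _ _ _
  simp only [thetaTerm, Q_cycleIntegral]
  simp only [Q, LinearMap.add_apply, h₁]
  have h₂ := C.Q_cycleIntegral c b
  rw [Q] at h₂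
  have h₃ : ∑ e, ((c - b).1 e : ℝ) * (c - b).1 e * C.len e
      = ∑ e, (c.1 e : ℝ) * c.1 e * C.len e - 2 * ∑ e, (c.1 e : ℝ) * b.1 e * C.len e
        + ∑ e, (b.1 e : ℝ) * b.1 e * C.len e := by
    rw [Finset.mul_sum, ← Finset.sum_sub_distrib, ← Finset.sum_add_distrib]
    refine Finset.sum_congr rfl fun e _ => ?_
    have : (c - b).1 e = c.1 e - b.1 e := rfl
    rw [this]
    push_cast
    ring
  rw [h₂, h₃]
  ring

/-- Quasi-periodicity of the theta function. -/
theorem theta_add_cycleIntegral (x : C.OmegaDual) (b : C.circuits) :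
    C.theta (x + C.cycleIntegral b)
      = C.theta x + x b + 1 / 2 * C.Q b (C.cycleIntegral b) := by
  apply le_antisymm
  · obtain ⟨c, hc⟩ := exists_thetaTerm_eq (x + C.cycleIntegral b)
    rw [← hc, thetaTerm_add_cycleIntegral]
    linarith [thetaTerm_le_theta (c - b) x]
  · obtain ⟨c, hc⟩ := exists_thetaTerm_eq x
    have := thetaTerm_le_theta (c + b) (x + C.cycleIntegral b)
    rw [thetaTerm_add_cycleIntegral, add_sub_cancel_right] at this
    linarith

/-- The coefficient of a cycle along a direction. -/
def dirCoeff : C.Direction → C.circuits → ℤ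
  | (.inl e, true), c => c.1 e
  | (.inl e, false), c => -c.1 e
  | (.inr _, _), _ => 0

theorem tangent_apply (d : C.Direction) (c : C.circuits) : C.tangent d c = dirCoeff d c := by
  rcases d with ⟨e | r, _ | _⟩ <;> simp [tangent, dirCoeff]

theorem sum_dirCoeff (p : C.Point) (c : C.circuits) : ∑ d ∈ C.dirs p, dirCoeff d c = 0 := by
  rcases p with (v | ⟨e, t, h₀, h₁⟩ | ⟨r, t, h₀⟩) | r
  · rw [sum_dirs_vertex]
    simp only [dirCoeff, c.2 v, Finset.sum_neg_distrib, Finset.sum_const_zero]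
    ring
  · simp [dirs, dirCoeff]
  · simp [dirs, dirCoeff]
  · simp [dirs, dirCoeff]

/-- The slope of the theta function along a direction of the curve. -/
def thetaSlope (x : C.OmegaDual) (d : C.Direction) : ℤ :=
  dirCoeff d (exists_theta_germ x (C.tangent d) (dirCoeff d) (tangent_apply d)).choose

theorem le_thetaSlope {x : C.OmegaDual} {c : C.circuits} (h : C.thetaTerm c x = C.theta x)
    (d : C.Direction) : dirCoeff d c ≤ thetaSlope x d :=
  (exists_theta_germ x (C.tangent d) (dirCoeff d) (tangent_apply d)).choose_spec.1 c h

theorem eventually_theta_eq (x : C.OmegaDual) (d : C.Direction) :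
    ∀ᶠ s : ℝ in 𝓝[>] 0, C.theta (x + s • C.tangent d) = C.theta x + thetaSlope x d * s :=
  (exists_theta_germ x (C.tangent d) (dirCoeff d) (tangent_apply d)).choose_spec.2

/-- Quasi-periodicity adds the affine function `x ↦ x b` plus a constant, whose slope along `d` is
the coefficient of `b`. -/
theorem thetaSlope_add_cycleIntegral (x : C.OmegaDual) (b : C.circuits) (d : C.Direction) :
    thetaSlope (x + C.cycleIntegral b) d = thetaSlope x d + dirCoeff d b := by
  refine slope_unique (eventually_theta_eq _ d) ?_
  filter_upwards [eventually_theta_eq x d] with s hs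
  rw [add_right_comm, theta_add_cycleIntegral, hs, theta_add_cycleIntegral, LinearMap.add_apply,
    LinearMap.smul_apply, tangent_apply, smul_eq_mul]
  push_cast
  ring

/-! ### The pull-back of the theta divisor -/

/-- The theta function along the edge `e`. -/
def edgeTheta (y : C.OmegaDual) (e : C.E) (t : ℝ) : ℝ :=
  C.theta (C.vertexLift (C.src e) + t • C.edgeFunctional e - y)

theorem rightSlope_edgeTheta (y : C.OmegaDual) (e : C.E) (t : ℝ) : RightSlope (edgeTheta y e) t
    (thetaSlope (C.vertexLift (C.src e) + t • C.edgeFunctional e - y) (.inl e, true)) := by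
  filter_upwards [eventually_theta_eq
    (C.vertexLift (C.src e) + t • C.edgeFunctional e - y) (.inl e, true)] with s hs
  rw [edgeTheta, edgeTheta, ← hs, tangent]
  congr 1
  module

theorem leftSlope_edgeTheta (y : C.OmegaDual) (e : C.E) (t : ℝ) : LeftSlope (edgeTheta y e) t
    (thetaSlope (C.vertexLift (C.src e) + t • C.edgeFunctional e - y) (.inl e, false)) := by
  filter_upwards [eventually_theta_eq
    (C.vertexLift (C.src e) + t • C.edgeFunctional e - y) (.inl e, false)] with s hs
  rw [edgeTheta, edgeTheta, ← hs, tangent]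
  congr 1
  module

theorem thetaSlope_leaf (x : C.OmegaDual) (r : C.R) (b : Bool) :
    thetaSlope x (.inr r, b) = 0 := rfl

theorem sum_thetaSlope_edge (y : C.OmegaDual) {e : C.E} {t : ℝ} (ht : t ∈ Set.Ioo 0 (C.len e)) :
    ∑ d ∈ C.dirs (.inl (C.edgePt e t)), thetaSlope (C.lift (.inl (C.edgePt e t)) - y) d
      = thetaSlope (C.vertexLift (C.src e) + t • C.edgeFunctional e - y) (.inl e, true)
        + thetaSlope (C.vertexLift (C.src e) + t • C.edgeFunctional e - y) (.inl e, false) := by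
  rw [C.sum_dirs_edge ht, C.lift_edgePt ⟨ht.1.le, ht.2⟩]

theorem finite_support_sum_thetaSlope (y : C.OmegaDual) :
    (Function.support fun p : C.Point => ∑ d ∈ C.dirs p, thetaSlope (C.lift p - y) d).Finite := by
  choose T hT hT' _ _ using fun e => hasBreakpoints (C.len_pos e)
    (fun t _ => rightSlope_edgeTheta y e t) (fun t _ => leftSlope_edgeTheta y e t)
  refine ((Set.finite_range (fun v : C.V => (Sum.inl (.vertex v) : C.Point))).union
    (Set.finite_iUnion fun e =>
      ((T e).finite_toSet.image fun t => (Sum.inl (C.edgePt e t) : C.Point)))).subset ?_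
  rintro ((v | ⟨e, t, h₀, h₁⟩ | ⟨r, t, h₀⟩) | r) hp
  · exact Or.inl ⟨v, rfl⟩
  · have he := C.edgePt_of_mem (e := e) ⟨h₀, h₁⟩
    refine Or.inr (Set.mem_iUnion.mpr ⟨e, t, hT' e t ⟨h₀, h₁⟩ ?_, by simp only [he]⟩)
    rw [← sum_thetaSlope_edge y ⟨h₀, h₁⟩, he]
    exact hp
  · exact absurd (by simp [dirs, thetaSlope_leaf]) hp
  · exact absurd (by simp [dirs, thetaSlope_leaf]) hp

/-- The pull-back to the curve of the theta divisor translated by `y`, with respect to the lift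
based at the base vertex. -/
def thetaDivisor (y : C.OmegaDual) : C.Divisor :=
  Finsupp.ofSupportFinite (fun p => ∑ d ∈ C.dirs p, thetaSlope (C.lift p - y) d)
    (finite_support_sum_thetaSlope y)

theorem thetaDivisor_apply (y : C.OmegaDual) (p : C.Point) :
    thetaDivisor y p = ∑ d ∈ C.dirs p, thetaSlope (C.lift p - y) d := rfl

/-- A maximal affine term touches Θ from below, and its outward slopes along the curve sum to 0 by
balancing. -/
theorem thetaDivisor_nonneg (y : C.OmegaDual) : 0 ≤ thetaDivisor y := by
  intro p
  obtain ⟨c, hc⟩ := exists_thetaTerm_eq (C.lift p - y)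
  rw [thetaDivisor_apply, Finsupp.coe_zero, Pi.zero_apply, ← sum_dirCoeff p c]
  exact Finset.sum_le_sum fun d _ => le_thetaSlope hc d

theorem thetaDivisor_pos {y : C.OmegaDual} {e : C.E} {t : ℝ} (ht : t ∈ Set.Ioo 0 (C.len e))
    {c c' : C.circuits} (hc : C.thetaTerm c (C.lift (.inl (C.edgePt e t)) - y)
      = C.theta (C.lift (.inl (C.edgePt e t)) - y))
    (hc' : C.thetaTerm c' (C.lift (.inl (C.edgePt e t)) - y)
      = C.theta (C.lift (.inl (C.edgePt e t)) - y)) (hne : c.1 e ≠ c'.1 e) :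
    0 < thetaDivisor y (.inl (C.edgePt e t)) := by
  rw [thetaDivisor_apply, C.sum_dirs_edge ht]
  have h₁ := le_thetaSlope hc (.inl e, true)
  have h₂ := le_thetaSlope hc (.inl e, false)
  have h₁' := le_thetaSlope hc' (.inl e, true)
  have h₂' := le_thetaSlope hc' (.inl e, false)
  simp only [dirCoeff] at h₁ h₂ h₁' h₂'
  omega

/-- The chosen path integral and the lift differ by a period, whose effect on the slopes is balanced
at every point. -/
theorem isThetaPullback_thetaDivisor (p₀ : C.Point) (l : C.OmegaDual) :
    C.IsThetaPullback p₀ l (thetaDivisor (l + C.lift p₀)) := by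
  intro p
  obtain ⟨b, hb⟩ : C.pathIntegral p₀ p - (C.lift p - C.lift p₀) ∈ C.lattice := by
    rw [← jac_eq_zero_iff, map_sub, map_sub, jac_pathIntegral, sub_self]
  have hp : C.pathIntegral p₀ p - l = C.lift p - (l + C.lift p₀) + C.cycleIntegral b := by
    rw [hb]
    abel
  refine ⟨thetaSlope (C.pathIntegral p₀ p - l), fun d _ => ?_, ?_⟩
  · filter_upwards [eventually_theta_eq (C.pathIntegral p₀ p - l) d] with s hs
    rw [← hs, add_sub_right_comm]
  · simp only [hp, thetaSlope_add_cycleIntegral, Finset.sum_add_distrib, sum_dirCoeff, add_zero]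
    rfl

theorem edgeTheta_zero (y : C.OmegaDual) (e : C.E) :
    edgeTheta y e 0 = C.theta (C.vertexLift (C.src e) - y) := by
  rw [edgeTheta, zero_smul, add_zero]

theorem edgeTheta_len (y : C.OmegaDual) (e : C.E) :
    edgeTheta y e (C.len e) = C.theta (C.vertexLift (C.tgt e) - y)
      + (C.vertexLift (C.tgt e) - y) (C.edgeCycle e)
      + 1 / 2 * C.Q (C.edgeCycle e) (C.cycleIntegral (C.edgeCycle e)) := by
  rw [← theta_add_cycleIntegral, vertexLift_tgt, edgeTheta]
  congr 1
  abel

/-- Polarization of the length form, using that the chain to the target plus the edge cycle is the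
chain to the source plus `e`. The half length of `e` that appears here produces the midpoints in
`midDivisor`. -/
theorem vertexLift_tgt_edgeCycle (e : C.E) : C.vertexLift (C.tgt e) (C.edgeCycle e)
      + 1 / 2 * C.Q (C.edgeCycle e) (C.cycleIntegral (C.edgeCycle e))
    = 1 / 2 * (∑ f, (C.chain (C.src e) f : ℝ) ^ 2 * C.len f)
      - 1 / 2 * (∑ f, (C.chain (C.tgt e) f : ℝ) ^ 2 * C.len f)
      + (C.chain (C.src e) e + 1 / 2) * C.len e := by
  have h : ((C.chain (C.src e) e : ℝ) + 1 / 2) * C.len e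
      = ∑ f, ((Pi.single e 1 : C.E → ℤ) f : ℝ) * ((C.chain (C.src e) f + 1 / 2) * C.len f) := by
    simp [Pi.single_apply]
  rw [h, Q_cycleIntegral, vertexLift, chainIntegral_apply, Finset.mul_sum, Finset.mul_sum,
    Finset.mul_sum, ← Finset.sum_add_distrib, ← Finset.sum_sub_distrib, ← Finset.sum_add_distrib]
  refine Finset.sum_congr rfl fun f _ => ?_
  have h' : ((Pi.single e 1 : C.E → ℤ) f : ℝ) ^ 2 = ((Pi.single e 1 : C.E → ℤ) f : ℝ) := by
    rw [Pi.single_apply]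
    split_ifs <;> simp
  rw [edgeCycle_apply]
  push_cast
  linear_combination (1 / 2 * C.len f) * h'

theorem liftSum_midDivisor : C.liftSum C.midDivisor
    = ∑ e, (C.vertexLift (C.src e) + (C.len e / 2) • C.edgeFunctional e)
      - ∑ v, C.vertexLift v := by
  rw [midDivisor, map_sub, map_sum, map_sum]
  simp only [liftSum_single, one_smul, C.lift_edgePt ⟨(half_len_mem _).1.le, (half_len_mem _).2⟩]
  rfl

/-- Regrouped by vertices, the coefficient is that of `∂(chain v)` at `v`; it is 0 at the base
vertex, but the lift vanishes there too. -/
theorem sum_chain_smul_vertexLift :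
    ∑ e, (C.chain (C.tgt e) e • C.vertexLift (C.tgt e)
        - C.chain (C.src e) e • C.vertexLift (C.src e))
      = ∑ v, C.vertexLift v := by
  calc _ = ∑ v, C.boundary (C.chain v) v • C.vertexLift v := by
        simp only [boundary_apply, sub_smul, Finset.sum_sub_distrib, Finset.sum_smul]
        rw [Fintype.sum_sum_fiber C.tgt fun e v => C.chain v e • C.vertexLift v,
          Fintype.sum_sum_fiber C.src fun e v => C.chain v e • C.vertexLift v]
    _ = ∑ v, C.vertexLift v := by
        refine Finset.sum_congr rfl fun v _ => ?_
        rw [boundary_chain, Pi.sub_apply, Pi.single_eq_same, Pi.single_apply]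
        split_ifs with h
        · rw [h, vertexLift_baseVertex, smul_zero]
        · rw [sub_zero, one_smul]

theorem sum_apply_edgeCycle_smul (y : C.OmegaDual) :
    ∑ e, y (C.edgeCycle e) • C.edgeFunctional e = y := by
  ext c
  rw [OmegaDual.apply_eq y c]
  simp only [LinearMap.sum_apply, LinearMap.smul_apply, edgeFunctional_apply, smul_eq_mul]
  exact Finset.sum_congr rfl fun e _ => mul_comm _ _

/-- Jacobi inversion: the degree and the sum in the Jacobian of the pull-back of a translate of
the theta divisor. -/
theorem degHom_and_jac_thetaDivisor (y : C.OmegaDual) :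
    C.degHom (thetaDivisor y) = C.genus ∧
    C.jac (C.liftSum (thetaDivisor y)) = C.jac y + C.jac (C.liftSum C.midDivisor) := by
  set l : C.E → ℝ → ℤ := fun e t =>
    thetaSlope (C.vertexLift (C.src e) + t • C.edgeFunctional e - y) (.inl e, false) with hl
  obtain ⟨hdeg, hsum⟩ := C.degHom_and_liftSum_eq (thetaDivisor y) (edgeTheta y)
    (fun e t => thetaSlope (C.vertexLift (C.src e) + t • C.edgeFunctional e - y) (.inl e, true)) l
    (fun e t _ => rightSlope_edgeTheta y e t) (fun e t _ => leftSlope_edgeTheta y e t)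
    (fun e t ht => sum_thetaSlope_edge y ht) (fun _ => 0)
    (fun r => ⟨∅, by simp, fun t ht h => absurd (by
      rw [thetaDivisor_apply, C.sum_dirs_leaf ht, thetaSlope_leaf, thetaSlope_leaf, add_zero]) h, by
      simp [thetaDivisor_apply, dirs, thetaSlope_leaf]⟩)
    -- The twist: at the target, the slope on the vertex lift and the slope on the edge lift differ
    -- by the coefficient of `e` in its own edge cycle. These sum to the genus.
    (fun e => (C.edgeCycle e).1 e) (fun v => by
      rw [thetaDivisor_apply, sum_dirs_vertex]
      congr 1
      congr 1
      · refine Finset.sum_congr rfl fun e he => ?_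
        rw [zero_smul, add_zero, (Finset.mem_filter.mp he).2]
        rfl
      · refine Finset.sum_congr rfl fun e he => ?_
        have : C.lift (.inl (.vertex v)) - y = C.vertexLift (C.src e)
            + C.len e • C.edgeFunctional e - y + C.cycleIntegral (-C.edgeCycle e) := by
          rw [← (Finset.mem_filter.mp he).2]
          change C.vertexLift _ - y = _
          rw [vertexLift_tgt, map_neg]
          abel
        rw [this, thetaSlope_add_cycleIntegral]
        simp [hl, dirCoeff])
  refine ⟨hdeg.trans C.sum_edgeCycle_diag, ?_⟩
  -- The quadratic correction turns the quasi-periodic increments of Θ into a coboundary, up to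
  -- terms linear in `y` and in the lengths.
  set A : C.V → ℝ := fun v => C.theta (C.vertexLift v - y)
    - 1 / 2 * ∑ f, (C.chain v f : ℝ) ^ 2 * C.len f with hA
  have hA' : ∑ e, (A (C.tgt e) - A (C.src e)) • C.edgeFunctional e = 0 := by
    ext c
    rw [LinearMap.zero_apply, ← C.sum_mul_coboundary c A]
    simp only [LinearMap.sum_apply, LinearMap.smul_apply, edgeFunctional_apply, smul_eq_mul]
    exact Finset.sum_congr rfl fun e _ => mul_comm _ _
  -- After summation over edges the parts become `y`, the midpoints, a vanishing coboundary, the sum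
  -- of the vertices, and periods.
  have hterm : ∀ e, -(edgeTheta y e (C.len e) - edgeTheta y e 0) • C.edgeFunctional e
      - l e (C.len e) • C.cycleIntegral (C.edgeCycle e)
      + (C.edgeCycle e).1 e • C.vertexLift (C.tgt e)
      = y (C.edgeCycle e) • C.edgeFunctional e
        + (C.vertexLift (C.src e) + (C.len e / 2) • C.edgeFunctional e)
        - (A (C.tgt e) - A (C.src e)) • C.edgeFunctional e
        - (C.chain (C.tgt e) e • C.vertexLift (C.tgt e)
          - C.chain (C.src e) e • C.vertexLift (C.src e))
        - (C.chain (C.src e) e + 1 + l e (C.len e)) • C.cycleIntegral (C.edgeCycle e) := by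
    intro e
    have h₁ : -(edgeTheta y e (C.len e) - edgeTheta y e 0) = -(A (C.tgt e) - A (C.src e))
        + y (C.edgeCycle e) - (C.chain (C.src e) e + 1 / 2) * C.len e := by
      rw [edgeTheta_len, edgeTheta_zero, LinearMap.sub_apply]
      simp only [hA]
      linarith [vertexLift_tgt_edgeCycle e]
    have h₂ : C.cycleIntegral (C.edgeCycle e) = C.vertexLift (C.src e)
        + C.len e • C.edgeFunctional e - C.vertexLift (C.tgt e) := by
      rw [vertexLift_tgt, sub_sub_cancel]
    rw [h₁, h₂, edgeCycle_apply, Pi.single_eq_same]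
    simp only [← Int.cast_smul_eq_zsmul ℝ]
    push_cast
    module
  rw [hsum, Finset.sum_congr rfl fun e _ => hterm e, liftSum_midDivisor, ← map_add]
  simp only [Finset.sum_sub_distrib, Finset.sum_add_distrib, hA', sum_apply_edgeCycle_smul]
  have h₃ := C.sum_chain_smul_vertexLift
  simp only [Finset.sum_sub_distrib] at h₃
  rw [h₃, map_sub, map_sum]
  simp only [map_zsmul, jac_cycleIntegral, smul_zero, Finset.sum_const_zero, sub_zero]
  congr 1
  abel

/-! ### The Abel-Jacobi bijection -/

theorem divisorClass_eq_iff {D D' : C.Divisor} :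
    C.divisorClass D = C.divisorClass D' ↔ D - D' ∈ C.principal := by
  rw [divisorClass, divisorClass, QuotientAddGroup.eq, ← neg_mem_iff, neg_add, neg_neg,
    sub_eq_add_neg]

theorem abelJacobi_sub (p₀ : C.Point) (D D' : C.Divisor) :
    C.abelJacobi p₀ (D - D') = C.abelJacobi p₀ D - C.abelJacobi p₀ D' := by
  simp only [abelJacobi_eq, map_sub, sub_smul]
  abel

theorem abelJacobi_nsmul (p₀ : C.Point) (n : ℕ) (D : C.Divisor) :
    C.abelJacobi p₀ (n • D) = n • C.abelJacobi p₀ D := by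
  simp only [abelJacobi_eq, map_nsmul, smul_sub, smul_assoc]

theorem divisorClass_eq_iff_abelJacobi (p₀ : C.Point) {D D' : C.Divisor}
    (h : C.deg D = C.deg D') :
    C.divisorClass D = C.divisorClass D' ↔ C.abelJacobi p₀ D = C.abelJacobi p₀ D' := by
  rw [deg_eq, deg_eq] at h
  rw [divisorClass_eq_iff, mem_principal_iff, ← sub_eq_zero (a := C.abelJacobi p₀ D),
    ← abelJacobi_sub, abelJacobi_eq, map_sub C.degHom, h, sub_self]
  simp

theorem abelJacobi_thetaDivisor (p₀ : C.Point) (l : C.OmegaDual) :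
    C.abelJacobi p₀ (thetaDivisor (l + C.lift p₀)) = C.jac l + C.abelJacobi p₀ C.midDivisor := by
  rw [abelJacobi_eq, abelJacobi_eq, (degHom_and_jac_thetaDivisor _).1,
    (degHom_and_jac_thetaDivisor _).2, degHom_midDivisor, map_add, sub_smul, one_smul]
  abel

theorem isRiemannConstant_midDivisor (p₀ : C.Point) :
    C.IsRiemannConstant p₀ (-C.abelJacobi p₀ C.midDivisor) := fun l =>
  ⟨_, isThetaPullback_thetaDivisor p₀ l, (degHom_and_jac_thetaDivisor _).1, by
    rw [abelJacobi_thetaDivisor, add_neg_cancel_right, toJacobian_eq]⟩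

theorem abelJacobi_single_self (p₀ : C.Point) (n : ℤ) :
    C.abelJacobi p₀ (Finsupp.single p₀ n) = 0 := by
  rw [abelJacobi_eq, liftSum_single, degHom_single, map_zsmul, sub_self]

/-- Jacobi inversion gives a divisor of degree g in every fibre; subtracting `p₀`, which maps to 0,
corrects the degree. -/
theorem exists_abelJacobi_eq (p₀ : C.Point) (x : C.Jacobian) :
    ∃ D, C.deg D = (C.genus : ℤ) - 1 ∧ C.abelJacobi p₀ D = x := by
  obtain ⟨l, hl⟩ := C.jac_surjective (x - C.abelJacobi p₀ C.midDivisor)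
  refine ⟨thetaDivisor (l + C.lift p₀) - Finsupp.single p₀ 1, ?_, ?_⟩
  · rw [deg_eq, map_sub, (degHom_and_jac_thetaDivisor _).1, degHom_single]
  · rw [abelJacobi_sub, abelJacobi_single_self, sub_zero, abelJacobi_thetaDivisor, hl,
      sub_add_cancel]

theorem bijective_abelJacobi (p₀ : C.Point) : Function.Bijective
    fun k : C.PicDeg ((C.genus : ℤ) - 1) => C.abelJacobi p₀ k.2.choose := by
  refine ⟨fun k k' h => Subtype.ext ?_, fun x => ?_⟩
  · have h₁ := k.2.choose_spec
    have h₂ := k'.2.choose_spec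
    rw [← h₁.2, ← h₂.2]
    exact (divisorClass_eq_iff_abelJacobi p₀ (h₁.1.trans h₂.1.symm)).mpr h
  · obtain ⟨D, hD, hx⟩ := exists_abelJacobi_eq p₀ x
    refine ⟨⟨C.divisorClass D, D, hD, rfl⟩, ?_⟩
    have hex : ∃ D', C.deg D' = (C.genus : ℤ) - 1 ∧ C.divisorClass D' = C.divisorClass D :=
      ⟨D, hD, rfl⟩
    rw [← hx]
    exact (divisorClass_eq_iff_abelJacobi p₀ (hex.choose_spec.1.trans hD.symm)).mp
      hex.choose_spec.2

/-- The bijection from `Pic^{g-1}` to the Jacobian induced by the Abel-Jacobi map. -/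
def picEquiv (p₀ : C.Point) : C.PicDeg ((C.genus : ℤ) - 1) ≃ C.Jacobian :=
  Equiv.ofBijective _ (bijective_abelJacobi p₀)

theorem picEquiv_apply (p₀ : C.Point) (D : C.Divisor) (hD : C.deg D = (C.genus : ℤ) - 1) :
    picEquiv p₀ ⟨C.divisorClass D, D, hD, rfl⟩ = C.abelJacobi p₀ D := by
  have hex : ∃ D', C.deg D' = (C.genus : ℤ) - 1 ∧ C.divisorClass D' = C.divisorClass D :=
    ⟨D, hD, rfl⟩
  exact (divisorClass_eq_iff_abelJacobi p₀ (hex.choose_spec.1.trans hD.symm)).mp hex.choose_spec.2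

/-! ### Half periods -/

theorem mem_halfPeriods_iff {y : C.Jacobian} : y ∈ C.halfPeriods ↔ (2 : ℕ) • y = 0 := by
  constructor
  · rintro ⟨l, hl, rfl⟩
    rw [toJacobian_eq, ← map_nsmul, jac_eq_zero_iff]
    convert hl using 1
    module
  · intro h
    obtain ⟨z, rfl⟩ := C.jac_surjective y
    rw [← map_nsmul, jac_eq_zero_iff] at h
    refine ⟨_, h, ?_⟩
    rw [toJacobian_eq]
    congr 1
    module

/-- The length form is positive definite. -/
theorem cycleIntegral_injective : Function.Injective C.cycleIntegral := by
  refine (injective_iff_map_eq_zero _).mpr fun c hc => ?_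
  have h := C.Q_cycleIntegral c c
  rw [hc, Q, LinearMap.zero_apply, eq_comm, Finset.sum_eq_zero_iff_of_nonneg fun e _ =>
    mul_nonneg (mul_self_nonneg _) (C.len_pos e).le] at h
  ext e
  have := h e (Finset.mem_univ e)
  simpa [(C.len_pos e).ne'] using this

variable (C) in
/-- Half of a cycle, as an element of the Jacobian. -/
def halfPeriod : C.circuits →+ C.Jacobian :=
  C.jac.comp ((DistribSMul.toAddMonoidHom C.OmegaDual (1 / 2 : ℝ)).comp C.cycleIntegral)

theorem halfPeriod_apply (c : C.circuits) :
    C.halfPeriod c = C.jac ((1 / 2 : ℝ) • C.cycleIntegral c) := rfl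

theorem halfPeriod_eq_zero_iff {c : C.circuits} :
    C.halfPeriod c = 0 ↔ ∃ b : C.circuits, (2 : ℤ) • b = c := by
  rw [halfPeriod_apply, jac_eq_zero_iff]
  constructor
  · rintro ⟨b, hb⟩
    refine ⟨b, cycleIntegral_injective ?_⟩
    rw [map_zsmul, hb, ← Int.cast_smul_eq_zsmul ℝ, smul_smul]
    norm_num
  · rintro ⟨b, rfl⟩
    refine ⟨b, ?_⟩
    rw [map_zsmul, ← Int.cast_smul_eq_zsmul ℝ, smul_smul]
    norm_num

theorem halfPeriods_eq_range : C.halfPeriods = Set.range C.halfPeriod := by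
  ext y
  constructor
  · rintro ⟨_, ⟨c, rfl⟩, rfl⟩
    exact ⟨c, rfl⟩
  · rintro ⟨c, rfl⟩
    exact ⟨_, ⟨c, rfl⟩, rfl⟩

/-- Halving cycles identifies ½Λ/Λ with the circuits modulo 2, and the circuits are free of rank g.
-/
theorem ncard_halfPeriods : C.halfPeriods.ncard = 2 ^ C.genus := by
  have hker : LinearMap.ker C.halfPeriod.toIntLinearMap
      = LinearMap.range (LinearMap.lsmul ℤ C.circuits (2 : ℕ)) := by
    ext c
    rw [LinearMap.mem_ker, LinearMap.mem_range]
    exact halfPeriod_eq_zero_iff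
  have h : Nat.card (ModN C.circuits 2) = 2 ^ C.genus := ModN.natCard_eq _ _
  rw [← h, halfPeriods_eq_range, ← Nat.card_coe_set_eq]
  exact Nat.card_congr ((Submodule.quotEquivOfEq _ _ hker).symm.trans
    C.halfPeriod.toIntLinearMap.quotKerEquivRange).symm.toEquiv

/-! ### Theta characteristics -/

theorem canonical_apply (p : C.Point) : C.canonical p = (C.val p : ℤ) - 2 := rfl

theorem canonical_vertex (v : C.V) : C.canonical (.inl (.vertex v))
    = ∑ e with C.src e = v, 1 + ∑ e with C.tgt e = v, 1 + ∑ r with C.root r = v, 1 - 2 := by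
  rw [← C.sum_dirs_vertex v fun _ => (1 : ℤ), Finset.sum_const, nsmul_one]
  rfl

theorem canonical_edge {e : C.E} {t : ℝ} (ht : t ∈ Set.Ioo 0 (C.len e)) :
    C.canonical (.inl (C.edgePt e t)) = 0 := by
  rw [C.edgePt_of_mem ht, canonical_apply]
  simp [val, dirs]

theorem canonical_leaf {r : C.R} {t : ℝ} (ht : 0 < t) :
    C.canonical (.inl (C.leafPt r t)) = 0 := by
  rw [C.leafPt_of_pos ht, canonical_apply]
  simp [val, dirs]

theorem canonical_end (r : C.R) : C.canonical (.inr r) = -1 := by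
  rw [canonical_apply]
  simp [val, dirs]

theorem sum_canonical {A : Type*} [AddCommGroup A] (g : C.Point → A) :
    (C.canonical.sum fun p n => n • g p)
      = ∑ e, (g (.inl (.vertex (C.src e))) + g (.inl (.vertex (C.tgt e))))
        + ∑ r, (g (.inl (.vertex (C.root r))) - g (.inr r))
        - (2 : ℤ) • ∑ v, g (.inl (.vertex v)) := by
  rw [C.sum_eq C.canonical (fun _ => ∅) (fun _ => ∅) (by simp) (by simp)
    (fun e t ht h => absurd (canonical_edge ht) h) (fun r t ht h => absurd (canonical_leaf ht) h)
    _ fun p => zero_smul ℤ (g p)]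
  simp only [canonical_vertex, canonical_end, Finset.sum_empty, Finset.sum_const_zero, add_zero,
    sub_smul, add_smul, Finset.sum_smul, one_smul, neg_smul, Finset.sum_sub_distrib,
    Finset.sum_add_distrib, Finset.sum_neg_distrib, Finset.smul_sum]
  rw [Fintype.sum_sum_fiber C.src fun _ v => g (.inl (.vertex v)),
    Fintype.sum_sum_fiber C.tgt fun _ v => g (.inl (.vertex v)),
    Fintype.sum_sum_fiber C.root fun _ v => g (.inl (.vertex v))]
  abel

theorem degHom_canonical : C.degHom C.canonical = 2 * (C.genus - 1) := by
  have h := sum_canonical (C := C) fun _ => (1 : ℤ)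
  simp only [smul_eq_mul, mul_one] at h
  rw [← deg_eq, deg, h, genus_eq]
  simp
  ring

/-- K is the sum of both ends of every edge and of root minus end of every leaf, minus twice the
vertices. Each leaf contributes 0, and the two ends of an edge give twice its midpoint up to a
period. -/
theorem jac_liftSum_canonical :
    C.jac (C.liftSum C.canonical) = (2 : ℕ) • C.jac (C.liftSum C.midDivisor) := by
  have h : C.liftSum C.canonical = (2 : ℕ) • C.liftSum C.midDivisor
      - ∑ e, C.cycleIntegral (C.edgeCycle e) := by
    have h₁ : ∀ e, C.vertexLift (C.src e) + C.vertexLift (C.tgt e)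
        = (2 : ℕ) • (C.vertexLift (C.src e) + (C.len e / 2) • C.edgeFunctional e)
          - C.cycleIntegral (C.edgeCycle e) := by
      intro e
      rw [vertexLift_tgt]
      module
    rw [liftSum_apply, sum_canonical, liftSum_midDivisor]
    simp only [lift, h₁, sub_self, Finset.sum_const_zero, add_zero, Finset.sum_sub_distrib,
      ← Finset.smul_sum, smul_sub]
    rw [← natCast_zsmul, ← natCast_zsmul]
    push_cast
    abel
  rw [h, map_sub, map_sum, map_nsmul]
  simp

theorem abelJacobi_canonical (p₀ : C.Point) :
    C.abelJacobi p₀ C.canonical = (2 : ℕ) • C.abelJacobi p₀ C.midDivisor := by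
  rw [abelJacobi_eq, abelJacobi_eq, jac_liftSum_canonical, degHom_canonical, degHom_midDivisor,
    smul_sub, mul_smul, ← natCast_zsmul (((C.genus : ℤ) - 1) • C.jac (C.lift p₀)) 2]
  rfl

theorem mem_thetaCharacteristics_iff (p₀ : C.Point) (k : C.PicDeg ((C.genus : ℤ) - 1)) :
    k ∈ C.thetaCharacteristics
      ↔ picEquiv p₀ k - C.abelJacobi p₀ C.midDivisor ∈ C.halfPeriods := by
  obtain ⟨_, D, hD, rfl⟩ := k
  have h₁ : (2 : ℕ) • C.divisorClass D = C.divisorClass ((2 : ℕ) • D) := rfl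
  have h₂ : C.deg ((2 : ℕ) • D) = C.deg C.canonical := by
    rw [deg_eq] at hD
    rw [deg_eq, deg_eq, map_nsmul, hD, degHom_canonical]
    simp
  rw [thetaCharacteristics, Set.mem_ofPred_eq, h₁, divisorClass_eq_iff_abelJacobi p₀ h₂,
    abelJacobi_nsmul, abelJacobi_canonical, mem_halfPeriods_iff, picEquiv_apply p₀ D hD, smul_sub,
    sub_eq_zero]

/-- At `c / 2` the term of `a` is half the length pairing of `a` with `c - a`, which is symmetric in
the two. -/
theorem thetaTerm_half_sub (c b : C.circuits) :
    C.thetaTerm (c - b) ((1 / 2 : ℝ) • C.cycleIntegral c)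
      = C.thetaTerm b ((1 / 2 : ℝ) • C.cycleIntegral c) := by
  have h : ∀ a, C.thetaTerm a ((1 / 2 : ℝ) • C.cycleIntegral c)
      = ∑ e, 1 / 2 * C.len e * (a.1 e * (c.1 e - a.1 e)) := by
    intro a
    have h₁ : C.Q a ((1 / 2 : ℝ) • C.cycleIntegral c) = 1 / 2 * C.Q a (C.cycleIntegral c) := rfl
    rw [thetaTerm, h₁, Q_cycleIntegral, Q_cycleIntegral, Finset.mul_sum, Finset.mul_sum,
      ← Finset.sum_sub_distrib]
    exact Finset.sum_congr rfl fun e _ => by ring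
  rw [h, h]
  refine Finset.sum_congr rfl fun e _ => ?_
  have : (c - b).1 e = c.1 e - b.1 e := rfl
  rw [this]
  push_cast
  ring

/-- At a corner of the theta function there is an effective divisor. -/
theorem exists_effective_of_corner (p₀ : C.Point) {x : C.OmegaDual} {c c' : C.circuits}
    (hc : C.thetaTerm c x = C.theta x) (hc' : C.thetaTerm c' x = C.theta x) (hne : c ≠ c') :
    ∃ D : C.Divisor, 0 ≤ D ∧ C.deg D = (C.genus : ℤ) - 1 ∧
      C.abelJacobi p₀ D = C.abelJacobi p₀ C.midDivisor - C.jac x := by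
  obtain ⟨e, he⟩ : ∃ e, c.1 e ≠ c'.1 e := by
    by_contra! h
    exact hne (Subtype.ext (funext h))
  have hq := half_len_mem (C := C) e
  set q : C.Point := .inl (C.edgePt e (C.len e / 2)) with hq'
  have hx : C.lift q - (C.lift q - x) = x := sub_sub_cancel _ _
  -- The translate is chosen so that `q`, on an edge where the two maximal terms have different
  -- slopes, maps to the corner `x`.
  have hpos : 0 < thetaDivisor (C.lift q - x) q :=
    thetaDivisor_pos hq (by rwa [hx]) (by rwa [hx]) he
  obtain ⟨h₁, h₂⟩ := degHom_and_jac_thetaDivisor (C.lift q - x)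
  refine ⟨thetaDivisor (C.lift q - x) - Finsupp.single q 1, fun p => ?_, ?_, ?_⟩
  · classical
    have := thetaDivisor_nonneg (C.lift q - x) p
    rw [Finsupp.sub_apply, Finsupp.single_apply]
    split_ifs with h
    · rw [← h, Finsupp.coe_zero, Pi.zero_apply]
      omega
    · rwa [sub_zero]
  · rw [deg_eq, map_sub, h₁, degHom_single]
  · rw [abelJacobi_eq, abelJacobi_eq, map_sub C.liftSum, map_sub C.degHom, map_sub C.jac, h₁, h₂,
      liftSum_single, degHom_single, degHom_midDivisor, one_smul, map_sub]
    abel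

/-- A maximal term `b` and its mirror `c - b` are distinct, as otherwise `c = 2b`. The resulting
corner gives the class with `c / 2` subtracted, which is the same as added since half periods are
2-torsion. -/
theorem mem_effectiveClasses_of_halfPeriod_ne_zero (p₀ : C.Point)
    {k : C.PicDeg ((C.genus : ℤ) - 1)} {c : C.circuits} (hc : C.halfPeriod c ≠ 0)
    (hk : picEquiv p₀ k = C.abelJacobi p₀ C.midDivisor + C.halfPeriod c) :
    k ∈ C.effectiveClasses ((C.genus : ℤ) - 1) := by
  obtain ⟨b, hb⟩ := exists_thetaTerm_eq ((1 / 2 : ℝ) • C.cycleIntegral c)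
  have hne : b ≠ c - b := fun h => hc (halfPeriod_eq_zero_iff.mpr ⟨b, by
    rw [two_smul]
    nth_rewrite 1 [h]
    exact sub_add_cancel c b⟩)
  obtain ⟨D, hD, hdeg, hD'⟩ := exists_effective_of_corner p₀ hb
    ((thetaTerm_half_sub c b).trans hb) hne
  refine ⟨D, hD, hdeg, ?_⟩
  have h2 : (2 : ℕ) • C.halfPeriod c = 0 := mem_halfPeriods_iff.mp
    (halfPeriods_eq_range ▸ Set.mem_range_self c)
  rw [two_smul] at h2
  have : picEquiv p₀ ⟨C.divisorClass D, D, hdeg, rfl⟩ = picEquiv p₀ k := by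
    rw [picEquiv_apply p₀ D hdeg, hD', hk, ← halfPeriod_apply, sub_eq_add_neg,
      neg_eq_of_add_eq_zero_left h2]
  exact congrArg Subtype.val ((picEquiv p₀).injective this)

theorem midDivisor_notMem_effectiveClasses (h : C.deg C.midDivisor = (C.genus : ℤ) - 1) :
    (⟨C.divisorClass C.midDivisor, C.midDivisor, h, rfl⟩ : C.PicDeg ((C.genus : ℤ) - 1))
      ∉ C.effectiveClasses ((C.genus : ℤ) - 1) := by
  rintro ⟨D, hD, -, hD'⟩
  exact sub_midDivisor_notMem_principal hD (divisorClass_eq_iff.mp hD')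

end TropicalCurve

end

/-! ### The main theorem -/

theorem mainTheorem2 (C : TropicalCurve) (p₀ : C.Point) :
    ∃ (φ : C.PicDeg ((C.genus : ℤ) - 1) ≃ C.Jacobian) (κ : C.Jacobian),
      (∀ (D : C.Divisor) (hD : C.deg D = (C.genus : ℤ) - 1),
        φ ⟨C.divisorClass D, D, hD, rfl⟩ = C.abelJacobi p₀ D) ∧
      C.IsRiemannConstant p₀ κ ∧
      C.thetaCharacteristics = {k | ∃ y ∈ C.halfPeriods, φ k = -κ + y} ∧
      C.thetaCharacteristics.ncard = 2 ^ C.genus ∧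
      ∀ k ∈ C.thetaCharacteristics,
        k ∉ C.effectiveClasses ((C.genus : ℤ) - 1) ↔ k = φ.symm (-κ) := by
  have hchar : C.thetaCharacteristics = {k | ∃ y ∈ C.halfPeriods,
      C.picEquiv p₀ k = -(-C.abelJacobi p₀ C.midDivisor) + y} := by
    ext k
    rw [TropicalCurve.mem_thetaCharacteristics_iff p₀, neg_neg]
    constructor
    · exact fun h => ⟨_, h, (add_sub_cancel _ _).symm⟩
    · rintro ⟨y, hy, h⟩
      rwa [h, add_sub_cancel_left]
  refine ⟨C.picEquiv p₀, -C.abelJacobi p₀ C.midDivisor, C.picEquiv_apply p₀,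
    C.isRiemannConstant_midDivisor p₀, hchar, ?_, fun k hk => ⟨fun hne => ?_, ?_⟩⟩
  · rw [← TropicalCurve.ncard_halfPeriods, hchar]
    rw [← Set.ncard_image_of_injective C.halfPeriods
      ((C.picEquiv p₀).symm.injective.comp
        (add_right_injective (-(-C.abelJacobi p₀ C.midDivisor))))]
    congr 1
    ext k
    exact exists_congr fun y => and_congr_right fun _ => by
      rw [Function.comp_apply, Equiv.symm_apply_eq, eq_comm]
  · rw [hchar] at hk
    obtain ⟨y, hy, hk⟩ := hk
    rw [TropicalCurve.halfPeriods_eq_range] at hy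
    obtain ⟨c, rfl⟩ := hy
    by_cases hc : C.halfPeriod c = 0
    · rw [Equiv.eq_symm_apply, hk, hc, add_zero]
    · rw [neg_neg] at hk
      exact absurd (C.mem_effectiveClasses_of_halfPeriod_ne_zero p₀ hc hk) hne
  · rintro rfl
    have hdeg : C.deg C.midDivisor = (C.genus : ℤ) - 1 := C.degHom_midDivisor
    rw [neg_neg, ← C.picEquiv_apply p₀ C.midDivisor hdeg, Equiv.symm_apply_apply]
    exact C.midDivisor_notMem_effectiveClasses hdeg
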